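/- A signed graph $\Sigma$ consists of finite sets $V$ of vertices and $E$ of edges, where each edge has exactly two ends, each end is connected to one vertex or to none, and at least one of the two ends is connected to a vertex, together with a sign function $\sigma:E\to\{-1,1\}$. An edge with an end connected to no vertex is an outer-edge; loops and multiple edges are allowed. A circle is a connected $2$-regular subgraph without outer-edges (a loop contributes $2$ to the degree); it is negative if the product of its edge signs is $-1$. A connected component is balanced if it contains neither outer-edges nor negative circles; $b(\Sigma)$ is the number of balanced components. The cycle-rank is $\mathrm{cr}(\Sigma)=|E|-(|V|-b(\Sigma))$. The negative cycle-rank (frustration) $\mathrm{cr}^-(\Sigma)$ is the least number of edges whose deletion leaves no negative circle, and the positive cycle-rank is $\mathrm{cr}^+(\Sigma)=\mathrm{cr}_{gr}(\Sigma)-\mathrm{cr}^-(\Sigma)$, where $\mathrm{cr}_{gr}(\Sigma)$ is the cycle-rank of the underlying unsigned graph (all edges taken positive). An arc is an edge with an arrow at each end, the two arrows having the same direction along the edge if the edge is positive and opposite directions if it is negative; so each edge carries exactly two, opposite, arcs. The incidence number $[v,\vec e\,]$ is the number of arrows of $\vec e$ at $v$ pointing to $v$ minus the number of those pointing away from $v$.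 For an abelian group $A$, a nowhere-zero flow is a function $f$ from arcs to $A\setminus\{0\}$ with $f(\vec e^{\,-1})=-f(\vec e\,)$ and $\sum_{e\in E}[v,\vec e\,]f(\vec e\,)=0$ for every vertex $v$ (for each $e$, either orientation may be used). The flow polynomial of $\Sigma$ is the polynomial $\varphi(\Sigma;t,x)\in\mathbb Z[t,x]$ such that for every finite abelian group $A$ the number of nowhere-zero flows of $\Sigma$ over $A$ equals $\varphi(\Sigma;|\mathrm{Tor}_2A|,|A|)$, where $\mathrm{Tor}_2A=\{a\in A:2a=0\}$. **Theorem (Degree Property).** Let $\Sigma$ be connected (in particular, with at least one vertex). Then the flow polynomial $\varphi=\varphi(\Sigma;t,x)$ exists and is unique. If $\varphi\neq0$, then $$\varphi(\Sigma;t,x)=\sum_{i=0}^{d}t^i\varphi_i(x),\qquad \varphi_i\in\mathbb Z[x],\quad \varphi_d\neq0,\quad d\le \mathrm{cr}^-(\Sigma)$$ (put $\varphi_i=0$ for $i>d$). Moreover: (a) If $\Sigma$ contains no negative circles, then $\varphi=\varphi_0$, and $\varphi_0$ is monic of degree $\mathrm{cr}(\Sigma)$. (b) If $\Sigma$ contains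 outer-edges, then $\varphi_0$ is monic of degree $\mathrm{cr}(\Sigma)$. (c) If $\Sigma$ contains negative circles and no outer-edges, then $\deg\varphi_0\le\mathrm{cr}^+(\Sigma)$. Here $\varphi_0$ can be zero: there is a connected $\Sigma$ with negative circles, no outer-edges and $\varphi\ne0$ for which $\varphi_0=0$. (In the bound the zero polynomial is given degree $0$.) (d) If $\Sigma$ contains negative circles and no outer-edges, then $\varphi_1$ is monic of degree $\mathrm{cr}(\Sigma)$. -/

import Mathlib

/-- A signed graph with vertex set `V` and edge set `E`.  Every edge has exactly two ends (indexed by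
`Fin 2`); each end is connected to one vertex or to none (`none`), and at least one of the two ends is
connected to a vertex.  Loops, multiple edges and outer-edges are allowed. -/
structure SignedGraph (V E : Type*) where
  /-- the vertex, if any, to which an end of an edge is connected -/
  ends : E → Fin 2 → Option V
  exists_end : ∀ e, ∃ i v, ends e i = some v
  /-- the sign of an edge -/
  sign : E → ℤˣ

namespace SignedGraph

variable {V E : Type*}

/-- An outer-edge is an edge having an end that is connected to no vertex. -/
def IsOuterEdge (G : SignedGraph V E) (e : E) : Prop :=
  ∃ i, G.ends e i = none

def HasOuterEdge (G : SignedGraph V E) : Prop :=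
  ∃ e, G.IsOuterEdge e

/-! ### Connectedness, circles, balance -/

/-- The adjacency of distinct vertices through edges belonging to `S`. -/
def adjGraph (G : SignedGraph V E) (S : Set E) : SimpleGraph V where
  Adj u v := u ≠ v ∧ ∃ e ∈ S, (G.ends e 0 = some u ∧ G.ends e 1 = some v) ∨
    (G.ends e 0 = some v ∧ G.ends e 1 = some u)
  symm := ⟨fun _ _ h => ⟨h.1.symm, h.2.imp fun _ he => ⟨he.1, he.2.symm⟩⟩⟩
  loopless := ⟨fun _ h => h.1 rfl⟩

/-- `G` has at least one vertex, and any two vertices are joined by a path. -/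
def IsConnected (G : SignedGraph V E) : Prop :=
  (G.adjGraph Set.univ).Connected

/-- The degree of `v` in the subgraph with edge set `S`: the number of ends of edges of `S` that are
connected to `v` (a loop contributes two). -/
noncomputable def degreeIn (G : SignedGraph V E) (S : Set E) (v : V) : ℕ :=
  {p : E × Fin 2 | p.1 ∈ S ∧ G.ends p.1 p.2 = some v}.ncard

/-- `v` is an endpoint of some edge of `S`. -/
def Touches (G : SignedGraph V E) (S : Set E) (v : V) : Prop :=
  ∃ e ∈ S, ∃ i, G.ends e i = some v

/-- `C` is the edge set of a circle: the subgraph formed by the edges of `C` and their endpoints is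
nonempty, contains no outer-edges, is 2-regular, and is connected. -/
structure IsCircle (G : SignedGraph V E) (C : Finset E) : Prop where
  nonempty : C.Nonempty
  not_outer : ∀ e ∈ C, ¬ G.IsOuterEdge e
  two_regular : ∀ v, G.Touches C v → G.degreeIn C v = 2
  connected : ∀ u v, G.Touches C u → G.Touches C v → (G.adjGraph C).Reachable u v

/-- A circle is negative if the product of the signs of its edges is `-1`. -/
def IsNegativeCircle (G : SignedGraph V E) (C : Finset E) : Prop :=
  G.IsCircle C ∧ ∏ e ∈ C, G.sign e = -1

def HasNegativeCircle (G : SignedGraph V E) : Prop :=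
  ∃ C, G.IsNegativeCircle C

/-- A connected component is balanced if it contains neither outer-edges nor negative circles. -/
def IsBalancedComponent (G : SignedGraph V E)
    (K : (G.adjGraph Set.univ).ConnectedComponent) : Prop :=
  (∀ e, G.IsOuterEdge e → ∀ i v, G.ends e i = some v → v ∉ K.supp) ∧
  (∀ C, G.IsNegativeCircle C → ∀ v, G.Touches C v → v ∉ K.supp)

/-- `b(G)`: the number of balanced components. -/
noncomputable def numBalanced (G : SignedGraph V E) : ℕ :=
  {K : (G.adjGraph Set.univ).ConnectedComponent | G.IsBalancedComponent K}.ncard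

/-! ### Cycle-ranks -/

/-- The rank `|V| - b(G)` of the frame matroid. -/
noncomputable def rank [Fintype V] (G : SignedGraph V E) : ℤ :=
  (Fintype.card V : ℤ) - G.numBalanced

/-- The cycle-rank `cr(G) = |E| - r(G)`. -/
noncomputable def cycleRank [Fintype V] [Fintype E] (G : SignedGraph V E) : ℤ :=
  (Fintype.card E : ℤ) - G.rank

/-- The underlying unsigned graph, that is, all edges are regarded as positive. -/
def unsigned (G : SignedGraph V E) : SignedGraph V E :=
  { G with sign := fun _ => 1 }

/-- The negative cycle-rank (frustration): the least number of edges whose deletion destroys all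
negative circles. -/
noncomputable def negCycleRank (G : SignedGraph V E) : ℕ :=
  sInf {k | ∃ S : Finset E, S.card = k ∧ ∀ C, G.IsNegativeCircle C → ¬ Disjoint C S}

/-- The positive cycle-rank: the cycle-rank of the underlying unsigned graph minus the negative
cycle-rank. -/
noncomputable def posCycleRank [Fintype V] [Fintype E] (G : SignedGraph V E) : ℤ :=
  G.unsigned.cycleRank - G.negCycleRank

/-! ### Oriented edges, flows and the flow polynomial -/

/-- An oriented edge: an edge together with an arrow at each of its ends, where `dir i = 1` means that
the arrow at the end `i` points out of the edge (towards the vertex there, if any), and `dir i = -1`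
that it points into the edge.  The two arrows have the same direction along the edge (hence
`dir 0 = - dir 1`) if the edge is positive, and opposite directions if it is negative. -/
@[ext]
structure Arc (G : SignedGraph V E) where
  edge : E
  dir : Fin 2 → ℤˣ
  dir_mul : dir 0 * dir 1 = - G.sign edge

/-- The opposite arc. -/
def Arc.rev {G : SignedGraph V E} (a : G.Arc) : G.Arc where
  edge := a.edge
  dir i := - a.dir i
  dir_mul := by simpa using a.dir_mul

open Classical in
/-- The incidence number `[v, a]`: it is `±1` for a non-loop arc at `v`, `±2` for a negative loop at
`v`, and `0` otherwise; the sign is `+` if the arc points to `v`. -/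
noncomputable def incidence (G : SignedGraph V E) (v : V) (a : G.Arc) : ℤ :=
  ∑ i, if G.ends a.edge i = some v then (a.dir i : ℤ) else 0

/-- One of the two orientations of the edge `e`. -/
def refArc (G : SignedGraph V E) (e : E) : G.Arc where
  edge := e
  dir i := if i = 0 then 1 else - G.sign e
  dir_mul := by simp

/-- A 1-chain with coefficients in `A`: a function on arcs taking opposite values on opposite arcs. -/
def IsChain {A : Type*} [AddCommGroup A] (G : SignedGraph V E) (c : G.Arc → A) : Prop :=
  ∀ a, c a.rev = - c a

/-- The boundary `v ↦ ∑ e, [v, e⃗] c(e⃗)`, where `e⃗` is any orientation of `e` (see `boundary_eq`). -/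
noncomputable def boundary [Fintype E] {A : Type*} [AddCommGroup A] (G : SignedGraph V E)
    (c : G.Arc → A) (v : V) : A :=
  ∑ e, G.incidence v (G.refArc e) • c (G.refArc e)

theorem incidence_rev (G : SignedGraph V E) (v : V) (a : G.Arc) :
    G.incidence v a.rev = - G.incidence v a := by
  simp only [incidence, Arc.rev, ← Finset.sum_neg_distrib]
  refine Finset.sum_congr rfl fun i _ => ?_
  by_cases h : G.ends a.edge i = some v <;> simp [h]

theorem eq_refArc_or_rev (G : SignedGraph V E) (a : G.Arc) :
    a = G.refArc a.edge ∨ a = (G.refArc a.edge).rev := by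
  obtain ⟨e, d, h⟩ := a
  rcases Int.units_eq_one_or (d 0) with h0 | h0
  · left
    ext i
    · rfl
    · fin_cases i
      · simp [refArc, h0]
      · rw [h0, one_mul] at h
        simp [refArc, h]
  · right
    ext i
    · rfl
    · fin_cases i
      · simp [refArc, Arc.rev, h0]
      · rw [h0, neg_one_mul, neg_inj] at h
        simp [refArc, Arc.rev, h]

/-- The boundary of a chain may be computed with any orientation `ω` of the edges. -/
theorem boundary_eq [Fintype E] {A : Type*} [AddCommGroup A] (G : SignedGraph V E)
    (c : G.Arc → A) (hc : G.IsChain c) (ω : E → G.Arc) (hω : ∀ e, (ω e).edge = e) (v : V) :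
    G.boundary c v = ∑ e, G.incidence v (ω e) • c (ω e) := by
  refine Finset.sum_congr rfl fun e _ => ?_
  have h := G.eq_refArc_or_rev (ω e)
  rw [hω e] at h
  rcases h with h | h <;> rw [h]
  rw [incidence_rev, hc, neg_smul_neg]

/-- The nowhere-zero flows with coefficients in `A`: the 1-chains with zero boundary that vanish on no
arc. -/
def nowhereZeroFlows [Fintype E] (G : SignedGraph V E) (A : Type*) [AddCommGroup A] :
    Set (G.Arc → A) :=
  {c | G.IsChain c ∧ (∀ v, G.boundary c v = 0) ∧ ∀ a, c a ≠ 0}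

/-- `φ`, a polynomial in `t` whose coefficients are polynomials in `x`, is the flow polynomial of `G`:
for each finite abelian group `A`, the number of nowhere-zero flows is the value of `φ` at
`x = |A|` and `t = |Tor₂(A)|`, where `Tor₂(A) = {a | 2a = 0}`. -/
def IsFlowPolynomial [Fintype E] (G : SignedGraph V E) (φ : Polynomial (Polynomial ℤ)) : Prop :=
  ∀ (A : Type) [AddCommGroup A] [Finite A],
    ((G.nowhereZeroFlows A).ncard : ℤ) =
      φ.evalEval (Nat.card A : ℤ) ({a : A | 2 • a = 0}.ncard : ℤ)

end SignedGraph

/-! ### Counting solutions of integral linear systems over finite abelian groups -/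

section Duality

/-! Inclusion–exclusion over supports writes the number of nowhere-zero flows as an alternating sum,
over edge sets S, of the number of flows vanishing off S. By character duality
(`card_pow_mul_card_ker_eq`) each such number equals, up to a power of |A|, the number of solutions
of the transposed system over the dual group, i.e. of potentials on (V, S). A potential is
determined on a component by its value at one vertex: arbitrary if the component can be switched to
be positive, 0 if it has an outer-edge, and any 2-torsion element otherwise. So each term is a
monomial in x and t (`numFlows_eq`), and `flowPolynomial` is explicit. It is unique because the
pairs (2^a q, 2^a) with q odd suffice to determine a polynomial.

The degree statements are read off from the exponents. The exponent of t counts components that each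
contain a negative circle, hence an edge of any set destroying all negative circles; this bounds it
by the frustration. The term S = E has coefficient +1, and its exponent of t is 0 or 1 by
connectedness. If another S had the same two exponents, every flow would vanish off S and φ would be
0; as the exponent of x is monotone in S, the coefficient containing the term S = E is monic. For
the bound on φ₀ without outer-edges, a set S contributing to φ₀ lies in the set T of edges satisfied
by some switching function, chosen with T connected and spanning; the complement of T meets every
negative circle, so the cycle-rank of T is at most cr⁺.

Circles and switching are linked by `exists_isNegativeCircle_subset`: a minimal set of edges that
cannot be switched to be positive is a negative circle. -/

theorem AddChar.map_finsetSum {ι A R : Type*} [AddCommMonoid A] [CommMonoid R] (ψ : AddChar A R)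
    (s : Finset ι) (f : ι → A) : ψ (∑ i ∈ s, f i) = ∏ i ∈ s, ψ (f i) :=
  map_prod ψ.toMonoidHom (fun i => Multiplicative.ofAdd (f i)) s

open Classical in
/-- A system of integral linear equations over a finite abelian group and the transposed system over
the dual group have the same number of solutions, up to the number of variables. -/
theorem card_pow_mul_card_ker_eq {V E A : Type*} [Fintype V] [Fintype E] [AddCommGroup A]
    [Finite A] (M : V → E → ℤ) :
    Nat.card A ^ Fintype.card V * Nat.card {f : E → A // ∀ v, ∑ e, M v e • f e = 0} =
      Nat.card A ^ Fintype.card E *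
        Nat.card {χ : V → AddChar A ℂ // ∀ e, ∑ v, M v e • χ v = 0} := by
  have := Fintype.ofFinite A
  -- Both sides are one bilinear pairing. Its sum over χ detects Mf = 0 and its sum over f detects
  -- Mᵀχ = 0, so the count follows by exchanging the sums.
  have key : ∀ (f : E → A) (χ : V → AddChar A ℂ),
      ∏ v, χ v (∑ e, M v e • f e) = ∏ e, (∑ v, M v e • χ v) (f e) := by
    intro f χ
    simp only [AddChar.map_finsetSum, AddChar.sum_apply, AddChar.map_zsmul_eq_zpow,
      AddChar.zsmul_apply]
    exact Finset.prod_comm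
  have h1 : ∑ f : E → A, ∑ χ : V → AddChar A ℂ, ∏ v, χ v (∑ e, M v e • f e) =
      (Fintype.card A : ℂ) ^ Fintype.card V *
        Fintype.card {f : E → A // ∀ v, ∑ e, M v e • f e = 0} := by
    have h0 : ∀ f : E → A, ∑ χ : V → AddChar A ℂ, ∏ v, χ v (∑ e, M v e • f e) =
        ∏ v, ∑ ψ : AddChar A ℂ, ψ (∑ e, M v e • f e) := fun f =>
      (Fintype.prod_sum fun v (ψ : AddChar A ℂ) => ψ (∑ e, M v e • f e)).symm
    simp_rw [h0, AddChar.sum_apply_eq_ite, Finset.prod_ite_zero, Finset.prod_const]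
    rw [← Finset.sum_filter, Finset.sum_const, Fintype.card_subtype]
    simp [mul_comm]
  have h2 : ∑ χ : V → AddChar A ℂ, ∑ f : E → A, ∏ e, (∑ v, M v e • χ v) (f e) =
      (Fintype.card A : ℂ) ^ Fintype.card E *
        Fintype.card {χ : V → AddChar A ℂ // ∀ e, ∑ v, M v e • χ v = 0} := by
    have h0 : ∀ χ : V → AddChar A ℂ, ∑ f : E → A, ∏ e, (∑ v, M v e • χ v) (f e) =
        ∏ e, ∑ a : A, (∑ v, M v e • χ v) a := fun χ =>
      (Fintype.prod_sum fun e (a : A) => (∑ v, M v e • χ v) a).symm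
    simp_rw [h0, AddChar.sum_eq_ite, Finset.prod_ite_zero, Finset.prod_const]
    rw [← Finset.sum_filter, Finset.sum_const, Fintype.card_subtype]
    simp [mul_comm]
  rw [Finset.sum_comm] at h1
  simp_rw [key] at h1
  rw [h1] at h2
  simp only [Nat.card_eq_fintype_card]
  exact_mod_cast h2

theorem natCard_addChar (A : Type*) [AddCommGroup A] [Finite A] :
    Nat.card (AddChar A ℂ) = Nat.card A := by
  have := Fintype.ofFinite A
  simp [Nat.card_eq_fintype_card]

/-- The duality for the 1 × 1 system with matrix (2). -/
theorem natCard_two_torsion_addChar (A : Type*) [AddCommGroup A] [Finite A] :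
    Nat.card {χ : AddChar A ℂ // 2 • χ = 0} = Nat.card {a : A // 2 • a = 0} := by
  have h := card_pow_mul_card_ker_eq (A := A) (fun (_ : Unit) (_ : Unit) => (2 : ℤ))
  have e1 : Nat.card {f : Unit → A // ∀ _ : Unit, ∑ e, (2 : ℤ) • f e = 0} =
      Nat.card {a : A // 2 • a = 0} :=
    Nat.card_congr ((Equiv.funUnique Unit A).subtypeEquiv fun f => by simp [two_zsmul, two_nsmul])
  have e2 : Nat.card {χ : Unit → AddChar A ℂ // ∀ _ : Unit, ∑ e, (2 : ℤ) • χ e = 0} =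
      Nat.card {χ : AddChar A ℂ // 2 • χ = 0} :=
    Nat.card_congr ((Equiv.funUnique Unit (AddChar A ℂ)).subtypeEquiv fun f => by
      simp [two_zsmul, two_nsmul])
  rw [e1, e2] at h
  exact (Nat.eq_of_mul_eq_mul_left (pow_pos Nat.card_pos _) h).symm

end Duality

/-! ### Inclusion–exclusion over supports -/

open Classical in
theorem natCard_nowhere_zero_eq_sum {E A : Type*} [Fintype E] [Zero A] [Finite A]
    (P : (E → A) → Prop) :
    (Nat.card {f : E → A // P f ∧ ∀ e, f e ≠ 0} : ℤ) =
      ∑ S : Finset E, (-1) ^ Sᶜ.card * (Nat.card {f : E → A // P f ∧ ∀ e ∉ S, f e = 0} : ℤ) := by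
  have := Fintype.ofFinite A
  have key : ∀ f : E → A, (if ∀ e, f e ≠ 0 then 1 else 0 : ℤ) =
      ∑ S : Finset E, (-1) ^ Sᶜ.card * (if ∀ e ∉ S, f e = 0 then 1 else 0) := by
    intro f
    have h := Finset.prod_add (fun e => -(if f e = 0 then 1 else 0 : ℤ)) (fun _ => (1 : ℤ))
      Finset.univ
    have h0 : ∀ e, (-(if f e = 0 then 1 else 0) + 1 : ℤ) = if f e ≠ 0 then 1 else 0 := by
      intro e; by_cases he : f e = 0 <;> simp [he]
    simp_rw [h0, Finset.prod_ite_zero, Finset.prod_const_one, Finset.powerset_univ, mul_one,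
      Finset.prod_neg, Finset.prod_ite_zero, Finset.prod_const_one] at h
    simp only [Finset.mem_univ, true_implies] at h
    rw [h]
    -- The expansion is indexed by the set where f is forced to vanish; its complement is the set S
    -- that may carry the support.
    refine Fintype.sum_equiv (Equiv.ofBijective _ compl_bijective) _ _ fun S => ?_
    simp
  simp only [Nat.card_eq_fintype_card, Fintype.card_subtype]
  simp only [Finset.card_filter, Nat.cast_sum, Nat.cast_ite, Nat.cast_one, Nat.cast_zero,
    Finset.mul_sum]
  rw [Finset.sum_comm]
  refine Finset.sum_congr rfl fun f _ => ?_
  by_cases hf : P f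
  · simpa [hf] using key f
  · simp [hf]

/-! ### Uniqueness of polynomials with prescribed values at `(|A|, |Tor₂ A|)` -/

theorem ncard_two_torsion_prod (a q : ℕ) (hq : Odd q) [NeZero q] :
    {x : (Fin a → ZMod 2) × ZMod q | 2 • x = 0}.ncard = 2 ^ a := by
  have h : {x : (Fin a → ZMod 2) × ZMod q | 2 • x = 0} =
      (fun y : Fin a → ZMod 2 => (y, (0 : ZMod q))) '' Set.univ := by
    ext ⟨y, z⟩
    have hu : IsUnit ((2 : ℕ) : ZMod q) := (ZMod.isUnit_iff_coprime 2 q).2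
      ((Nat.coprime_two_left).2 hq)
    have hy : 2 • y = 0 := by
      funext i
      have : ∀ b : ZMod 2, 2 • b = 0 := by decide
      exact this (y i)
    have hz : 2 • z = 0 ↔ z = 0 := by
      rw [nsmul_eq_mul]
      exact hu.mul_right_eq_zero
    simp only [Set.mem_ofPred_eq, Prod.smul_mk, Prod.mk_eq_zero, hy, hz, true_and, Set.image_univ,
      Set.mem_range, Prod.mk.injEq, exists_eq_left]
    exact eq_comm
  rw [h, Set.ncard_image_of_injective _ fun y z hyz => (Prod.mk.inj hyz).1, Set.ncard_univ]
  simp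

/-- The groups (ℤ/2)^a × ℤ/(2k+1) realise t = 2^a with infinitely many x. So ψ at t = 2^a is zero in
ℤ[x] for every a, and ψ has infinitely many roots over the domain ℤ[x]. -/
theorem polynomial_eq_zero_of_evalEval_card_eq_zero (ψ : Polynomial (Polynomial ℤ))
    (h : ∀ (A : Type) [AddCommGroup A] [Finite A],
      ψ.evalEval (Nat.card A : ℤ) ({a : A | 2 • a = 0}.ncard : ℤ) = 0) : ψ = 0 := by
  have hpow : Function.Injective fun a : ℕ => (2 : ℤ) ^ a :=
    pow_right_injective₀ (by norm_num) (by norm_num)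
  have h1 : ∀ a : ℕ, ψ.eval (Polynomial.C ((2 : ℤ) ^ a)) = 0 := by
    intro a
    refine Polynomial.eq_zero_of_infinite_isRoot _ ?_
    refine Set.infinite_of_injective_forall_mem
      (f := fun k : ℕ => (2 : ℤ) ^ a * ((2 * k + 1 : ℕ) : ℤ)) ?_ ?_
    · intro k l hkl
      have := mul_left_cancel₀ (pow_ne_zero a two_ne_zero) hkl
      omega
    · intro k
      have := h ((Fin a → ZMod 2) × ZMod (2 * k + 1))
      rw [ncard_two_torsion_prod a _ (odd_two_mul_add_one k)] at this
      simpa [Polynomial.evalEval, Nat.card_prod] using this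
  refine Polynomial.eq_zero_of_infinite_isRoot _ ?_
  exact Set.infinite_of_injective_forall_mem
    (f := fun a : ℕ => Polynomial.C ((2 : ℤ) ^ a)) (Polynomial.C_injective.comp hpow) h1

namespace SignedGraph

variable {V E : Type*}

/-! ### Potentials and their number -/

/-- `s` satisfies the edge `e`: the edge is not an outer-edge, and its sign is the product of the
values of `s` at its ends. -/
def Satisfies (G : SignedGraph V E) (s : V → ℤˣ) (e : E) : Prop :=
  ∃ u v, G.ends e 0 = some u ∧ G.ends e 1 = some v ∧ s u = G.sign e * s v

/-- The edge `e` meets the set `X` of vertices. -/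
def Meets (G : SignedGraph V E) (e : E) (X : Set V) : Prop :=
  ∃ i, ∃ v ∈ X, G.ends e i = some v

/-- The component `K` of the subgraph with edge set `S` can be switched to be positive. -/
def IsSwitchable (G : SignedGraph V E) (S : Set E) (K : (G.adjGraph S).ConnectedComponent) : Prop :=
  ∃ s : V → ℤˣ, ∀ e ∈ S, G.Meets e K.supp → G.Satisfies s e

/-- The component `K` of the subgraph with edge set `S` has an outer-edge. -/
def HasOuterAt (G : SignedGraph V E) (S : Set E) (K : (G.adjGraph S).ConnectedComponent) : Prop :=
  ∃ e ∈ S, G.Meets e K.supp ∧ G.IsOuterEdge e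

/-- The number of components of the subgraph with edge set `S` that can be switched to be
positive. -/
noncomputable def numSwitchable (G : SignedGraph V E) (S : Set E) : ℕ :=
  {K | G.IsSwitchable S K}.ncard

/-- The number of components of the subgraph with edge set `S` that have no outer-edge and cannot
be switched to be positive. -/
noncomputable def numUnswitchable (G : SignedGraph V E) (S : Set E) : ℕ :=
  {K | ¬ G.IsSwitchable S K ∧ ¬ G.HasOuterAt S K}.ncard

/-- A potential on the subgraph with edge set `S`: its values at the ends of an edge agree up to the
sign of the edge, where the missing end of an outer-edge has the value `0`. -/
def IsPotential {B : Type*} [AddCommGroup B] (G : SignedGraph V E) (S : Set E) (g : V → B) : Prop :=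
  ∀ e ∈ S, (G.ends e 0).elim 0 g = (G.sign e : ℤ) • (G.ends e 1).elim 0 g

theorem Satisfies.not_isOuterEdge {G : SignedGraph V E} {s : V → ℤˣ} {e : E}
    (h : G.Satisfies s e) : ¬ G.IsOuterEdge e := by
  obtain ⟨u, v, h0, h1, -⟩ := h
  rintro ⟨i, hi⟩
  fin_cases i <;> simp_all

theorem exists_ends_of_not_isOuterEdge {G : SignedGraph V E} {e : E} (h : ¬ G.IsOuterEdge e) :
    ∃ u v, G.ends e 0 = some u ∧ G.ends e 1 = some v := by
  simp only [IsOuterEdge, not_exists] at h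
  obtain ⟨u, hu⟩ := Option.ne_none_iff_exists'.1 (h 0)
  obtain ⟨v, hv⟩ := Option.ne_none_iff_exists'.1 (h 1)
  exact ⟨u, v, hu, hv⟩

theorem reachable_of_ends {G : SignedGraph V E} {S : Set E} {e : E} (he : e ∈ S) {u v : V}
    (hu : G.ends e 0 = some u) (hv : G.ends e 1 = some v) : (G.adjGraph S).Reachable u v := by
  by_cases h : u = v
  · exact h ▸ SimpleGraph.Reachable.refl _
  · exact SimpleGraph.Adj.reachable ⟨h, e, he, Or.inl ⟨hu, hv⟩⟩

theorem mem_supp_of_meets {G : SignedGraph V E} {S : Set E} {e : E} (he : e ∈ S) {u v : V}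
    (hu : G.ends e 0 = some u) (hv : G.ends e 1 = some v) {K : (G.adjGraph S).ConnectedComponent}
    (hm : G.Meets e K.supp) : u ∈ K.supp ∧ v ∈ K.supp := by
  have huv := SimpleGraph.ConnectedComponent.sound (reachable_of_ends he hu hv)
  simp only [Meets, SimpleGraph.ConnectedComponent.mem_supp_iff] at hm ⊢
  obtain ⟨i, w, hw, hi⟩ := hm
  fin_cases i
  · obtain rfl : u = w := by simpa [hu] using hi
    exact ⟨hw, huv ▸ hw⟩
  · obtain rfl : v = w := by simpa [hv] using hi
    exact ⟨huv.trans hw, hw⟩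

theorem isSwitchable_not_hasOuterAt {G : SignedGraph V E} {S : Set E}
    {K : (G.adjGraph S).ConnectedComponent} (h : G.IsSwitchable S K) : ¬ G.HasOuterAt S K := by
  rintro ⟨e, he, hm, ho⟩
  obtain ⟨s, hs⟩ := h
  exact (hs e he hm).not_isOuterEdge ho

theorem units_smul_eq_or {B : Type*} [AddCommGroup B] (σ : ℤˣ) (b : B) :
    (σ : ℤ) • b = b ∨ (σ : ℤ) • b = -b := by
  rcases Int.units_eq_one_or σ with h | h <;> simp [h]

theorem units_smul_smul {B : Type*} [AddCommGroup B] (σ τ : ℤˣ) (b : B) :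
    (σ : ℤ) • (τ : ℤ) • b = ((σ * τ : ℤˣ) : ℤ) • b := by
  rw [smul_smul, Units.val_mul]

theorem IsPotential.eq_or_eq_neg_of_reachable {B : Type*} [AddCommGroup B] {G : SignedGraph V E}
    {S : Set E} {g : V → B} (hg : G.IsPotential S g) {u v : V} (h : (G.adjGraph S).Reachable u v) :
    g v = g u ∨ g v = - g u := by
  obtain ⟨p⟩ := h
  induction p with
  | nil => exact Or.inl rfl
  | @cons u w v h p ih =>
    have hw : g w = g u ∨ g w = - g u := by
      obtain ⟨-, e, he, ⟨h0, h1⟩ | ⟨h0, h1⟩⟩ := h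
      · have := hg e he
        simp only [h0, h1, Option.elim_some] at this
        rcases units_smul_eq_or (G.sign e) (g w) with h2 | h2 <;> rw [h2] at this <;> simp [this]
      · have := hg e he
        simp only [h0, h1, Option.elim_some] at this
        rcases units_smul_eq_or (G.sign e) (g u) with h2 | h2 <;> rw [h2] at this <;> simp [this]
    rcases ih with ih | ih <;> rcases hw with hw | hw <;> simp [ih, hw]

theorem IsPotential.eq_zero_of_hasOuterAt {B : Type*} [AddCommGroup B] {G : SignedGraph V E}
    {S : Set E} {g : V → B} (hg : G.IsPotential S g) {K : (G.adjGraph S).ConnectedComponent}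
    (h : G.HasOuterAt S K) {v : V} (hv : v ∈ K.supp) : g v = 0 := by
  obtain ⟨e, he, ⟨i, w, hw, hi⟩, j, hj⟩ := h
  have h0 : g w = 0 := by
    have := hg e he
    fin_cases i <;> fin_cases j <;> simp_all
    rcases units_smul_eq_or (G.sign e) (g w) with h2 | h2 <;> simp_all
  rcases hg.eq_or_eq_neg_of_reachable (K.reachable_of_mem_supp hw hv) with h | h <;> simp [h, h0]

/-- All values on K are ±g(r), and g(r) ≠ -g(r) makes these signs well defined; the potential
equations then say that the signs switch K to be positive. -/
theorem IsPotential.isSwitchable {B : Type*} [AddCommGroup B] {G : SignedGraph V E}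
    {S : Set E} {g : V → B} (hg : G.IsPotential S g) {K : (G.adjGraph S).ConnectedComponent}
    {r : V} (hr : r ∈ K.supp) (h2 : 2 • g r ≠ 0) : G.IsSwitchable S K := by
  classical
  have hne : g r ≠ - g r := fun h => h2 (by rw [two_nsmul]; nth_rewrite 1 [h]; simp)
  have hs : ∀ v ∈ K.supp, g v = ((if g v = g r then 1 else -1 : ℤˣ) : ℤ) • g r := by
    intro v hv
    rcases hg.eq_or_eq_neg_of_reachable (K.reachable_of_mem_supp hr hv) with h | h
    · simp [h]
    · simp [h, hne.symm]
  have hinj : ∀ σ τ : ℤˣ, (σ : ℤ) • g r = (τ : ℤ) • g r → σ = τ := by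
    intro σ τ h
    rcases Int.units_eq_one_or σ with h1 | h1 <;> rcases Int.units_eq_one_or τ with h3 | h3 <;>
      simp only [h1, h3, Units.val_one, one_smul, Units.val_neg, neg_smul] at h ⊢
    · exact (hne h).elim
    · exact (hne h.symm).elim
  refine ⟨fun v => if g v = g r then 1 else -1, fun e he hm => ?_⟩
  have hno : ¬ G.IsOuterEdge e := by
    intro ho
    have := hg.eq_zero_of_hasOuterAt ⟨e, he, hm, ho⟩ hr
    exact h2 (by simp [this])
  obtain ⟨u, v, hu, hv⟩ := exists_ends_of_not_isOuterEdge hno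
  obtain ⟨huK, hvK⟩ := mem_supp_of_meets he hu hv hm
  refine ⟨u, v, hu, hv, hinj _ _ ?_⟩
  have := hg e he
  simp only [hu, hv, Option.elim_some] at this
  rw [← units_smul_smul, ← hs u huK, ← hs v hvK]
  exact this

theorem IsPotential.sub {B : Type*} [AddCommGroup B] {G : SignedGraph V E} {S : Set E}
    {g g' : V → B} (hg : G.IsPotential S g) (hg' : G.IsPotential S g') :
    G.IsPotential S (g - g') := by
  intro e he
  have h : ∀ o : Option V, o.elim 0 (g - g') = o.elim 0 g - o.elim 0 g' := by
    rintro (_ | v) <;> simp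
  rw [h, h, smul_sub, hg e he, hg' e he]

/-- The values that a potential may take on the component `K`. -/
def allowedValues (G : SignedGraph V E) (S : Set E) (B : Type*) [AddCommGroup B]
    (K : (G.adjGraph S).ConnectedComponent) : Set B :=
  {b | (¬ G.IsSwitchable S K → 2 • b = 0) ∧ (G.HasOuterAt S K → b = 0)}

open Classical in
theorem natCard_allowedValues (G : SignedGraph V E) (S : Set E) (B : Type*) [AddCommGroup B]
    (K : (G.adjGraph S).ConnectedComponent) :
    Nat.card (G.allowedValues S B K) = (if G.IsSwitchable S K then Nat.card B else 1) *
      (if ¬ G.IsSwitchable S K ∧ ¬ G.HasOuterAt S K then Nat.card {b : B // 2 • b = 0} else 1) := by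
  by_cases h : G.IsSwitchable S K
  · have : G.allowedValues S B K = Set.univ := by
      simp [allowedValues, h, isSwitchable_not_hasOuterAt h]
    simp [h, this]
  · by_cases ho : G.HasOuterAt S K
    · have : G.allowedValues S B K = {0} := by
        ext b
        simp only [allowedValues, h, ho, Set.mem_ofPred_eq, Set.mem_singleton_iff,
          not_false_eq_true, true_implies, and_iff_right_iff_imp]
        rintro rfl
        simp
      simp [h, ho, this]
    · simp only [h, ho, allowedValues, if_false, not_false_eq_true, and_self, if_true, one_mul,
        true_implies, false_implies, and_true]
      rfl

/-- Evaluation at one base vertex per component is a bijection onto the product of the allowed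
values. Injectivity: a difference of potentials that is 0 at the base is 0 throughout the component.
Surjectivity: the base value is spread by switching signs. -/
theorem natCard_isPotential [Fintype V] (G : SignedGraph V E) (S : Set E) (B : Type*)
    [AddCommGroup B] :
    Nat.card {g : V → B // G.IsPotential S g} =
      Nat.card B ^ G.numSwitchable S * Nat.card {b : B // 2 • b = 0} ^ G.numUnswitchable S := by
  classical
  have := Fintype.ofFinite (G.adjGraph S).ConnectedComponent
  let F : {g : V → B // G.IsPotential S g} → ∀ K, G.allowedValues S B K := fun g K =>
    ⟨g.1 K.out, fun h => by
      by_contra h2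
      exact h (g.2.isSwitchable (K.out_eq) h2),
      fun h => g.2.eq_zero_of_hasOuterAt h K.out_eq⟩
  have hF : Function.Bijective F := by
    constructor
    · intro g g' h
      refine Subtype.ext (funext fun v => ?_)
      have hr := congrArg Subtype.val (congrFun h ((G.adjGraph S).connectedComponentMk v))
      have hv := SimpleGraph.ConnectedComponent.exact
        ((G.adjGraph S).connectedComponentMk v).out_eq
      have hd := (g.2.sub g'.2).eq_or_eq_neg_of_reachable hv
      have h0 : (g.1 - g'.1) ((G.adjGraph S).connectedComponentMk v).out = 0 := sub_eq_zero.2 hr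
      rw [h0, neg_zero, or_self] at hd
      exact sub_eq_zero.1 hd
    · intro a
      have hex : ∀ K : (G.adjGraph S).ConnectedComponent, ∃ s : V → ℤˣ, s K.out = 1 ∧
          (G.IsSwitchable S K → ∀ e ∈ S, G.Meets e K.supp → G.Satisfies s e) := by
        intro K
        by_cases h : G.IsSwitchable S K
        · obtain ⟨s, hs⟩ := h
          -- Rescaling by the value at the base vertex makes the sign there 1.
          refine ⟨fun v => s K.out * s v, Int.units_mul_self _, fun _ e he hm => ?_⟩
          obtain ⟨u, v, hu, hv, h⟩ := hs e he hm
          refine ⟨u, v, hu, hv, ?_⟩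
          change s _ * s u = G.sign e * (s _ * s v)
          rw [h, mul_left_comm]
        · exact ⟨1, rfl, fun h' => (h h').elim⟩
      choose s hs1 hs2 using hex
      refine ⟨⟨fun v => (s ((G.adjGraph S).connectedComponentMk v) v : ℤ) •
        (a ((G.adjGraph S).connectedComponentMk v)).1, fun e he => ?_⟩, ?_⟩
      · by_cases ho : G.IsOuterEdge e
        · have h0 : ∀ i w, G.ends e i = some w →
              (a ((G.adjGraph S).connectedComponentMk w)).1 = 0 := fun i w hi =>
            (a ((G.adjGraph S).connectedComponentMk w)).2.2 ⟨e, he, ⟨i, w, rfl, hi⟩, ho⟩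
          have h1 := h0 0
          have h2 := h0 1
          rcases h3 : G.ends e 0 with _ | u <;> rcases h4 : G.ends e 1 with _ | v <;> simp_all
        · obtain ⟨u, v, hu, hv⟩ := exists_ends_of_not_isOuterEdge ho
          have huv := SimpleGraph.ConnectedComponent.sound (reachable_of_ends he hu hv)
          simp only [hu, hv, Option.elim_some]
          rw [huv, units_smul_smul]
          set K := (G.adjGraph S).connectedComponentMk v with hK
          by_cases h : G.IsSwitchable S K
          · obtain ⟨u', v', hu', hv', h'⟩ := hs2 K h e he ⟨1, v, rfl, hv⟩
            rw [hu] at hu'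
            rw [hv] at hv'
            obtain rfl := Option.some.inj hu'
            obtain rfl := Option.some.inj hv'
            rw [h']
          -- On an unswitchable component the value is 2-torsion, so signs do not matter.
          · have h2 : ∀ σ : ℤˣ, (σ : ℤ) • (a K).1 = (a K).1 := by
              intro σ
              have h2 := (a K).2.1 h
              rw [two_nsmul] at h2
              rcases units_smul_eq_or σ (a K).1 with h3 | h3
              · exact h3
              · rw [h3, neg_eq_of_add_eq_zero_left h2]
            rw [h2, h2]
      · refine funext fun K => Subtype.ext ?_
        have hK : (G.adjGraph S).connectedComponentMk K.out = K := K.out_eq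
        change (s ((G.adjGraph S).connectedComponentMk K.out) K.out : ℤ) •
          (a ((G.adjGraph S).connectedComponentMk K.out)).1 = (a K).1
        rw [hK, hs1]
        simp
  rw [Nat.card_congr (Equiv.ofBijective F hF), Nat.card_pi]
  simp_rw [natCard_allowedValues, Finset.prod_mul_distrib, Finset.prod_ite, Finset.prod_const_one,
    Finset.prod_const, mul_one, numSwitchable, numUnswitchable, Set.ncard_eq_toFinset_card',
    Set.toFinset_ofPred]

/-! ### Flows supported in a set of edges -/

/-- The flows with values in `A`, written as functions on the edges. -/
def IsFlow [Fintype E] {A : Type*} [AddCommGroup A] (G : SignedGraph V E) (f : E → A) : Prop :=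
  ∀ v, ∑ e, G.incidence v (G.refArc e) • f e = 0

/-- The number of flows with values in `A` that vanish outside `S`. -/
noncomputable def numFlows [Fintype E] (G : SignedGraph V E) (S : Finset E) (A : Type*)
    [AddCommGroup A] : ℕ :=
  Nat.card {f : E → A // G.IsFlow f ∧ ∀ e ∉ S, f e = 0}

theorem sum_incidence_smul [Fintype V] {B : Type*} [AddCommGroup B] (G : SignedGraph V E) (e : E)
    (g : V → B) : ∑ v, G.incidence v (G.refArc e) • g v =
      (G.ends e 0).elim 0 g - (G.sign e : ℤ) • (G.ends e 1).elim 0 g := by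
  classical
  have h : ∀ (o : Option V) (n : ℤ), ∑ v, (if o = some v then n else 0) • g v =
      n • o.elim 0 g := by
    rintro (_ | w) n
    · simp
    · simp [ite_smul]
  have h0 := h (G.ends e 0) 1
  have h1 := h (G.ends e 1) (-(G.sign e : ℤ))
  simp only [incidence, Fin.sum_univ_two, add_smul, Finset.sum_add_distrib, refArc, if_true,
    Units.val_one, Units.val_neg, one_ne_zero, if_false]
  rw [h0, h1, one_smul, neg_smul, sub_eq_add_neg]

/-- Potentials are the kernel of the transposed incidence matrix, which is what the duality pairs
with flows. -/
theorem isPotential_iff [Fintype V] {B : Type*} [AddCommGroup B] (G : SignedGraph V E)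
    (S : Set E) (g : V → B) :
    G.IsPotential S g ↔ ∀ e ∈ S, ∑ v, G.incidence v (G.refArc e) • g v = 0 := by
  simp only [IsPotential, sum_incidence_smul, sub_eq_zero]

theorem numFlows_eq_natCard [Fintype E] (G : SignedGraph V E) (S : Finset E)
    (A : Type*) [AddCommGroup A] : G.numFlows S A =
      Nat.card {f : S → A // ∀ v, ∑ e : S, G.incidence v (G.refArc e) • f e = 0} := by
  classical
  have hsum : ∀ (f : E → A), (∀ e ∉ S, f e = 0) → ∀ v, ∑ e, G.incidence v (G.refArc e) • f e =
      ∑ e : S, G.incidence v (G.refArc e) • f e := by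
    intro f hf v
    rw [Finset.sum_coe_sort S fun e => G.incidence v (G.refArc e) • f e]
    exact (Finset.sum_subset (Finset.subset_univ S) fun e _ he => by rw [hf e he, smul_zero]).symm
  refine Nat.card_congr
    { toFun := fun f => ⟨fun e => f.1 e, fun v => by rw [← hsum f.1 f.2.2 v]; exact f.2.1 v⟩
      invFun := fun f => ⟨fun e => if h : e ∈ S then f.1 ⟨e, h⟩ else 0, ?_, ?_⟩
      left_inv := ?_
      right_inv := ?_ }
  · intro v
    rw [hsum _ (fun e he => dif_neg he)]
    simpa using f.2 v
  · exact fun e he => dif_neg he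
  · intro f
    refine Subtype.ext (funext fun e => ?_)
    by_cases he : e ∈ S
    · simp [he]
    · simp [he, f.2.2 e he]
  · intro f
    exact Subtype.ext (funext fun e => by simp)

theorem card_pow_mul_numFlows [Fintype V] [Fintype E] (G : SignedGraph V E) (S : Finset E)
    (A : Type*) [AddCommGroup A] [Finite A] :
    Nat.card A ^ Fintype.card V * G.numFlows S A =
      Nat.card A ^ (S.card + G.numSwitchable S) *
        Nat.card {a : A // 2 • a = 0} ^ G.numUnswitchable S := by
  have h := card_pow_mul_card_ker_eq (A := A) fun (v : V) (e : S) => G.incidence v (G.refArc e)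
  rw [numFlows_eq_natCard, h, Fintype.card_coe, pow_add, mul_assoc]
  congr 1
  have h2 := natCard_isPotential G S (AddChar A ℂ)
  rw [natCard_addChar, natCard_two_torsion_addChar] at h2
  rw [← h2]
  refine Nat.card_congr (Equiv.subtypeEquivRight fun χ => ?_)
  simp [isPotential_iff]

/-- Over ℤ/3 the torsion factor disappears, so comparing numbers of flows compares exponents of 3.
-/
theorem natCard_two_torsion_zmod_three : Nat.card {a : ZMod 3 // 2 • a = 0} = 1 := by
  rw [Nat.card_eq_fintype_card]
  decide

theorem numFlows_pos [Fintype E] (G : SignedGraph V E) (S : Finset E) (A : Type*)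
    [AddCommGroup A] [Finite A] : 0 < G.numFlows S A := by
  have : Nonempty {f : E → A // G.IsFlow f ∧ ∀ e ∉ S, f e = 0} :=
    ⟨⟨0, fun v => by simp, fun _ _ => rfl⟩⟩
  exact Nat.card_pos

/-- The number of flows over ℤ/3 is a positive integer, so its exponent is nonnegative. Hence the
truncated subtraction in `cycleRankOn` loses nothing. -/
theorem card_le_card_add_numSwitchable [Fintype V] [Fintype E] (G : SignedGraph V E)
    (S : Finset E) : Fintype.card V ≤ S.card + G.numSwitchable S := by
  have h := G.card_pow_mul_numFlows S (ZMod 3)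
  rw [natCard_two_torsion_zmod_three, one_pow, mul_one, Nat.card_zmod] at h
  have h2 : 3 ^ Fintype.card V ≤ 3 ^ (S.card + G.numSwitchable S) := by
    rw [← h]
    exact Nat.le_mul_of_pos_right _ (G.numFlows_pos S (ZMod 3))
  exact (Nat.pow_le_pow_iff_right (by norm_num)).1 h2

/-- The cycle-rank of the subgraph with edge set `S`. -/
noncomputable def cycleRankOn [Fintype V] (G : SignedGraph V E) (S : Finset E) : ℕ :=
  S.card + G.numSwitchable S - Fintype.card V

theorem cycleRankOn_add_card [Fintype V] [Fintype E] (G : SignedGraph V E) (S : Finset E) :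
    G.cycleRankOn S + Fintype.card V = S.card + G.numSwitchable S :=
  Nat.sub_add_cancel (G.card_le_card_add_numSwitchable S)

theorem numFlows_eq [Fintype V] [Fintype E] (G : SignedGraph V E) (S : Finset E)
    (A : Type*) [AddCommGroup A] [Finite A] :
    G.numFlows S A = Nat.card A ^ G.cycleRankOn S *
      Nat.card {a : A // 2 • a = 0} ^ G.numUnswitchable S := by
  have h := G.card_pow_mul_numFlows S A
  rw [← cycleRankOn_add_card, add_comm, pow_add, mul_assoc] at h
  exact Nat.eq_of_mul_eq_mul_left (pow_pos Nat.card_pos _) h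

theorem numFlows_zmod_three [Fintype V] [Fintype E] (G : SignedGraph V E) (S : Finset E) :
    G.numFlows S (ZMod 3) = 3 ^ G.cycleRankOn S := by
  rw [numFlows_eq, natCard_two_torsion_zmod_three, one_pow, mul_one, Nat.card_zmod]

theorem numFlows_mono [Fintype E] (G : SignedGraph V E) {S T : Finset E} (h : S ⊆ T) (A : Type*)
    [AddCommGroup A] [Finite A] : G.numFlows S A ≤ G.numFlows T A :=
  Nat.card_le_card_of_injective
    (fun f => ⟨f.1, f.2.1, fun e he => f.2.2 e fun hS => he (h hS)⟩)
    fun _ _ hfg => Subtype.ext (congrArg (fun x => x.1) hfg)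

theorem cycleRankOn_mono [Fintype V] [Fintype E] (G : SignedGraph V E) {S T : Finset E}
    (h : S ⊆ T) : G.cycleRankOn S ≤ G.cycleRankOn T := by
  have := G.numFlows_mono h (ZMod 3)
  rw [numFlows_zmod_three, numFlows_zmod_three] at this
  exact (Nat.pow_le_pow_iff_right (by norm_num)).1 this

/-- The chain with the value `f e` at the reference orientation of `e`. -/
def chainOf {A : Type*} [AddCommGroup A] (G : SignedGraph V E) (f : E → A) (a : G.Arc) : A :=
  (a.dir 0 : ℤ) • f a.edge

theorem chainOf_refArc {A : Type*} [AddCommGroup A] (G : SignedGraph V E) (f : E → A) (e : E) :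
    G.chainOf f (G.refArc e) = f e := by
  simp [chainOf, refArc]

theorem isChain_chainOf {A : Type*} [AddCommGroup A] (G : SignedGraph V E) (f : E → A) :
    G.IsChain (G.chainOf f) := by
  intro a
  simp [chainOf, Arc.rev]

theorem IsChain.eq_chainOf {A : Type*} [AddCommGroup A] {G : SignedGraph V E} {c : G.Arc → A}
    (hc : G.IsChain c) : c = G.chainOf fun e => c (G.refArc e) := by
  funext a
  rcases G.eq_refArc_or_rev a with h | h
  · rw [h]
    exact (G.chainOf_refArc (fun e => c (G.refArc e)) a.edge).symm
  · rw [h, hc, G.isChain_chainOf (A := A), chainOf_refArc]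

theorem ncard_nowhereZeroFlows [Fintype E] (G : SignedGraph V E) (A : Type*) [AddCommGroup A] :
    (G.nowhereZeroFlows A).ncard =
      Nat.card {f : E → A // G.IsFlow f ∧ ∀ e, f e ≠ 0} := by
  refine Nat.card_congr
    { toFun := fun c => ⟨fun e => c.1 (G.refArc e), c.2.2.1, fun e => c.2.2.2 _⟩
      invFun := fun f => ⟨G.chainOf f.1, G.isChain_chainOf _, fun v => ?_, fun a => ?_⟩
      left_inv := fun c => Subtype.ext c.2.1.eq_chainOf.symm
      right_inv := fun f => Subtype.ext (funext fun e => G.chainOf_refArc _ _) }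
  · simpa only [boundary, chainOf_refArc] using f.2.1 v
  · have := f.2.2 a.edge
    rcases units_smul_eq_or (a.dir 0) (f.1 a.edge) with h | h <;> simpa [chainOf, h] using this

/-! ### The flow polynomial -/

open Polynomial in
/-- The flow polynomial, written as an alternating sum over sets of edges. -/
noncomputable def flowPolynomial [Fintype V] [Fintype E] (G : SignedGraph V E) : ℤ[X][X] :=
  ∑ S : Finset E, monomial (G.numUnswitchable S)
    ((-1) ^ (Fintype.card E - S.card) * X ^ G.cycleRankOn S)

theorem isFlowPolynomial_flowPolynomial [Fintype V] [Fintype E] (G : SignedGraph V E) :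
    G.IsFlowPolynomial G.flowPolynomial := by
  classical
  intro A _ _
  rw [ncard_nowhereZeroFlows, natCard_nowhere_zero_eq_sum, flowPolynomial,
    Polynomial.evalEval, Polynomial.eval_finsetSum, Polynomial.eval_finsetSum]
  refine Finset.sum_congr rfl fun S _ => ?_
  have h := G.numFlows_eq S A
  rw [numFlows] at h
  rw [h, Finset.card_compl]
  have h2 : {a : A | 2 • a = 0}.ncard = Nat.card {a : A // 2 • a = 0} := rfl
  simp [h2, mul_assoc]

theorem IsFlowPolynomial.unique [Fintype E] {G : SignedGraph V E}
    {φ ψ : Polynomial (Polynomial ℤ)} (hφ : G.IsFlowPolynomial φ) (hψ : G.IsFlowPolynomial ψ) :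
    ψ = φ := by
  refine sub_eq_zero.1 (polynomial_eq_zero_of_evalEval_card_eq_zero _ fun A _ _ => ?_)
  rw [Polynomial.evalEval_sub, ← hφ A, ← hψ A, sub_self]

/-- Equal finite counts force every flow to vanish off S, in particular on some edge. No group then
has a nowhere-zero flow, and uniqueness applies. -/
theorem flowPolynomial_eq_zero_of_numFlows_eq [Fintype V] [Fintype E] {G : SignedGraph V E}
    {S : Finset E} (hS : S ≠ Finset.univ)
    (h : ∀ (A : Type) [AddCommGroup A] [Finite A], G.numFlows S A = G.numFlows Finset.univ A) :
    G.flowPolynomial = 0 := by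
  classical
  refine IsFlowPolynomial.unique (G := G) (φ := 0) ?_ G.isFlowPolynomial_flowPolynomial
  intro A _ _
  obtain ⟨e, he⟩ : ∃ e, e ∉ S := by
    by_contra! h
    exact hS (Finset.eq_univ_iff_forall.2 h)
  have hsurj : Function.Surjective
      (fun f => ⟨f.1, f.2.1, fun e he => f.2.2 e fun hS => he (Finset.subset_univ S hS)⟩ :
      {f : E → A // G.IsFlow f ∧ ∀ e ∉ S, f e = 0} →
      {f : E → A // G.IsFlow f ∧ ∀ e ∉ Finset.univ, f e = 0}) :=
    ((Nat.bijective_iff_injective_and_card _).2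
      ⟨fun _ _ hfg => Subtype.ext (congrArg (fun x => x.1) hfg), h A⟩).2
  have : IsEmpty {f : E → A // G.IsFlow f ∧ ∀ e, f e ≠ 0} := by
    refine ⟨fun f => ?_⟩
    obtain ⟨g, hg⟩ := hsurj ⟨f.1, f.2.1, fun e he => (he (Finset.mem_univ e)).elim⟩
    refine f.2.2 e ?_
    exact (congrFun (congrArg (fun x => x.1) hg) e).symm.trans (g.2.2 e he)
  rw [ncard_nowhereZeroFlows]
  simp

/-! ### Coefficients of the flow polynomial -/

open Polynomial in
theorem coeff_flowPolynomial [Fintype V] [Fintype E] (G : SignedGraph V E) (i : ℕ) :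
    G.flowPolynomial.coeff i =
      ∑ S ∈ Finset.univ.filter (fun S : Finset E => G.numUnswitchable (S : Set E) = i),
      (-1) ^ (Fintype.card E - S.card) * X ^ G.cycleRankOn S := by
  simp [flowPolynomial, finsetSum_coeff, coeff_monomial, Finset.sum_filter]

open Polynomial in
theorem natDegree_neg_one_pow_mul_X_pow_le (m n : ℕ) :
    ((-1) ^ m * X ^ n : ℤ[X]).natDegree ≤ n := by
  rcases neg_one_pow_eq_or ℤ[X] m with h | h <;> simp [h]

open Polynomial in
/-- The coefficient of the flow polynomial contributed to by the set of all edges is monic. -/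
theorem monic_coeff_flowPolynomial [Fintype V] [Fintype E] (G : SignedGraph V E)
    (h0 : G.flowPolynomial ≠ 0) :
    (G.flowPolynomial.coeff (G.numUnswitchable (Finset.univ : Finset E))).Monic ∧
      (G.flowPolynomial.coeff (G.numUnswitchable (Finset.univ : Finset E))).natDegree =
        G.cycleRankOn Finset.univ := by
  classical
  have hdeg : degree (∑ S ∈ (Finset.univ.filter fun S : Finset E => G.numUnswitchable (S : Set E) =
      G.numUnswitchable (Finset.univ : Finset E)).erase Finset.univ,
      ((-1) ^ (Fintype.card E - S.card) * X ^ G.cycleRankOn S : ℤ[X])) <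
        (G.cycleRankOn Finset.univ : WithBot ℕ) := by
    refine (degree_sum_le _ _).trans_lt ((Finset.sup_lt_iff (WithBot.bot_lt_coe _)).2 ?_)
    intro S hS
    simp only [Finset.mem_erase, Finset.mem_filter, Finset.mem_univ, true_and] at hS
    refine lt_of_le_of_lt (degree_le_of_natDegree_le (natDegree_neg_one_pow_mul_X_pow_le _ _)) ?_
    -- Equal exponents of x, besides equal exponents of t, would give equal numbers of flows over
    -- every group, hence φ = 0.
    refine Nat.cast_lt.2 (lt_of_le_of_ne (G.cycleRankOn_mono (Finset.subset_univ S)) fun h => ?_)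
    refine h0 (flowPolynomial_eq_zero_of_numFlows_eq hS.1 fun A _ _ => ?_)
    rw [numFlows_eq, numFlows_eq, h, hS.2]
  have hc : G.flowPolynomial.coeff (G.numUnswitchable (Finset.univ : Finset E)) =
      X ^ G.cycleRankOn Finset.univ + ∑ S ∈ (Finset.univ.filter fun S : Finset E =>
        G.numUnswitchable S = G.numUnswitchable (Finset.univ : Finset E)).erase Finset.univ,
      ((-1) ^ (Fintype.card E - S.card) * X ^ G.cycleRankOn S : ℤ[X]) := by
    have hmem : (Finset.univ : Finset E) ∈ Finset.univ.filter fun S : Finset E =>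
        G.numUnswitchable (S : Set E) = G.numUnswitchable (Finset.univ : Finset E) := by
      simp only [Finset.mem_filter, Finset.mem_univ, true_and]
    rw [coeff_flowPolynomial, ← Finset.add_sum_erase _ _ hmem]
    simp
  rw [hc]
  exact ⟨monic_X_pow_add hdeg, by
    rw [natDegree_add_eq_left_of_degree_lt (by rwa [degree_X_pow]), natDegree_X_pow]⟩

/-! ### Negative circles and switching -/

open Classical in
/-- The function `s` with its sign changed on `X`. -/
noncomputable def flip (X : Set V) (s : V → ℤˣ) (v : V) : ℤˣ :=
  if v ∈ X then - s v else s v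

theorem not_satisfies_iff {G : SignedGraph V E} {s : V → ℤˣ} {e : E} {u v : V}
    (hu : G.ends e 0 = some u) (hv : G.ends e 1 = some v) :
    ¬ G.Satisfies s e ↔ s u = - (G.sign e * s v) := by
  have h : G.Satisfies s e ↔ s u = G.sign e * s v := by
    refine ⟨?_, fun h => ⟨u, v, hu, hv, h⟩⟩
    rintro ⟨u', v', hu', hv', h⟩
    rw [hu] at hu'
    rw [hv] at hv'
    obtain rfl := Option.some.inj hu'
    obtain rfl := Option.some.inj hv'
    exact h
  rw [h]
  exact Int.units_ne_iff_eq_neg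

theorem Satisfies.flip {G : SignedGraph V E} {s : V → ℤˣ} {e : E} (h : G.Satisfies s e)
    {X : Set V} (hX : ∀ u v, G.ends e 0 = some u → G.ends e 1 = some v → (u ∈ X ↔ v ∈ X)) :
    G.Satisfies (flip X s) e := by
  obtain ⟨u, v, hu, hv, h⟩ := h
  refine ⟨u, v, hu, hv, ?_⟩
  have := hX u v hu hv
  by_cases hvX : v ∈ X <;> simp_all [SignedGraph.flip]

theorem satisfies_flip_of_not_satisfies {G : SignedGraph V E} {s : V → ℤˣ} {e : E} {u v : V}
    (hu : G.ends e 0 = some u) (hv : G.ends e 1 = some v) (h : ¬ G.Satisfies s e) {X : Set V}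
    (hX : u ∈ X ↔ v ∉ X) : G.Satisfies (flip X s) e := by
  rw [not_satisfies_iff hu hv] at h
  refine ⟨u, v, hu, hv, ?_⟩
  by_cases hvX : v ∈ X <;> simp_all [SignedGraph.flip]

open Classical in
theorem degreeIn_eq_card (G : SignedGraph V E) (C : Finset E) (v : V) :
    G.degreeIn C v =
      ((C ×ˢ (Finset.univ : Finset (Fin 2))).filter fun p => G.ends p.1 p.2 = some v).card := by
  rw [degreeIn, ← Set.ncard_coe_finset]
  congr 1
  ext p
  simp

-- Double counting of edge ends. A general monoid allows both products of signs and, through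
-- `Multiplicative ℕ`, the handshake lemma.
open Classical in
theorem prod_ends_eq [Fintype V] {M : Type*} [CommMonoid M] (G : SignedGraph V E) (C : Finset E)
    (s : V → M) :
    ∏ e ∈ C, (G.ends e 0).elim 1 s * (G.ends e 1).elim 1 s = ∏ v, s v ^ G.degreeIn C v := by
  have h : ∀ o : Option V, o.elim 1 s = ∏ v, if o = some v then s v else 1 := by
    rintro (_ | w) <;> simp
  have h1 : ∀ e, (G.ends e 0).elim 1 s * (G.ends e 1).elim 1 s =
      ∏ i, ∏ v, if G.ends e i = some v then s v else 1 := by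
    intro e
    rw [Fin.prod_univ_two, h, h]
  simp_rw [h1, degreeIn_eq_card]
  rw [← Finset.prod_product' C Finset.univ
    (fun e i => ∏ v, if G.ends e i = some v then s v else 1), Finset.prod_comm]
  refine Finset.prod_congr rfl fun v _ => ?_
  rw [Finset.prod_ite, Finset.prod_const_one, mul_one, Finset.prod_const]

theorem degreeIn_eq_zero {G : SignedGraph V E} {C : Finset E} {v : V} (h : ¬ G.Touches C v) :
    G.degreeIn C v = 0 := by
  classical
  rw [degreeIn_eq_card, Finset.card_eq_zero, Finset.filter_eq_empty_iff]
  intro p hp hv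
  exact h ⟨p.1, (Finset.mem_product.1 hp).1, p.2, hv⟩

theorem prod_ends_eq_one [Fintype V] {G : SignedGraph V E} {C : Finset E}
    (hC : ∀ v, G.Touches C v → G.degreeIn C v = 2) (s : V → ℤˣ) :
    ∏ e ∈ C, (G.ends e 0).elim 1 s * (G.ends e 1).elim 1 s = 1 := by
  rw [prod_ends_eq]
  refine Finset.prod_eq_one fun v _ => ?_
  by_cases hv : G.Touches C v
  · rw [hC v hv, Int.units_sq]
  · rw [degreeIn_eq_zero hv, pow_zero]

theorem Satisfies.sign_eq {G : SignedGraph V E} {s : V → ℤˣ} {e : E} (h : G.Satisfies s e) :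
    G.sign e = (G.ends e 0).elim 1 s * (G.ends e 1).elim 1 s := by
  obtain ⟨u, v, hu, hv, h⟩ := h
  simp [hu, hv, h, mul_assoc, Int.units_mul_self]

/-- If s satisfied all edges, the product of the signs would contain s at each vertex of the circle
twice, and so be 1. -/
theorem IsNegativeCircle.exists_not_satisfies [Fintype V] {G : SignedGraph V E} {C : Finset E}
    (hC : G.IsNegativeCircle C) (s : V → ℤˣ) : ∃ e ∈ C, ¬ G.Satisfies s e := by
  by_contra! h
  have h1 := prod_ends_eq_one hC.1.two_regular s
  rw [← Finset.prod_congr rfl fun e he => (h e he).sign_eq, hC.2] at h1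
  exact absurd h1 (by decide)

/-- A minimal set of edges that cannot be switched to be positive. -/
structure IsMinimalUnbalanced (G : SignedGraph V E) (C : Finset E) : Prop where
  not_outer : ∀ e ∈ C, ¬ G.IsOuterEdge e
  exists_not : ∀ s, ∃ e ∈ C, ¬ G.Satisfies s e
  minimal : ∀ e ∈ C, ∃ s, ∀ e' ∈ C, e' ≠ e → G.Satisfies s e'

/-! ### Minimal unbalanced sets are negative circles -/

namespace IsMinimalUnbalanced

variable {G : SignedGraph V E} {C : Finset E}

theorem not_satisfies (hC : G.IsMinimalUnbalanced C) {s : V → ℤˣ} {e : E}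
    (hs : ∀ e' ∈ C, e' ≠ e → G.Satisfies s e') : ¬ G.Satisfies s e := by
  obtain ⟨e', he', h⟩ := hC.exists_not s
  by_cases h' : e' = e
  · exact h' ▸ h
  · exact (h (hs e' he' h')).elim

theorem nonempty (hC : G.IsMinimalUnbalanced C) : C.Nonempty := by
  obtain ⟨e, he, -⟩ := hC.exists_not 1
  exact ⟨e, he⟩

/-- Otherwise a function failing only at an edge e₂ at v, used on the component of u, and one
failing only at an edge e₁ at u, used elsewhere, glue to a function satisfying all of C. -/
theorem connected (hC : G.IsMinimalUnbalanced C) {u v : V} (hu : G.Touches C u)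
    (hv : G.Touches C v) : (G.adjGraph C).Reachable u v := by
  classical
  by_contra hne
  obtain ⟨e₁, he₁, i₁, h₁⟩ := hu
  obtain ⟨e₂, he₂, i₂, h₂⟩ := hv
  obtain ⟨s₁, hs₁⟩ := hC.minimal e₂ he₂
  obtain ⟨s₂, hs₂⟩ := hC.minimal e₁ he₁
  let X : Set V := {w | (G.adjGraph C).Reachable u w}
  have hX : ∀ e ∈ C, ∀ i j a b, G.ends e i = some a → G.ends e j = some b → a ∈ X → b ∈ X := by
    intro e he i j a b ha hb haX
    obtain ⟨x, y, hx, hy⟩ := exists_ends_of_not_isOuterEdge (hC.not_outer e he)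
    have hxy : (G.adjGraph C).Reachable x y := reachable_of_ends (Finset.mem_coe.2 he) hx hy
    have haX' : (G.adjGraph C).Reachable u a := haX
    change (G.adjGraph C).Reachable u b
    have hab : (G.adjGraph C).Reachable a b := by
      fin_cases i <;> fin_cases j <;> simp_all
      exact hxy.symm
    exact haX'.trans hab
  have huX : u ∈ X := SimpleGraph.Reachable.refl u
  have hvX : v ∉ X := hne
  obtain ⟨e, he, hns⟩ := hC.exists_not fun w => if w ∈ X then s₁ w else s₂ w
  obtain ⟨a, b, ha, hb⟩ := exists_ends_of_not_isOuterEdge (hC.not_outer e he)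
  rw [not_satisfies_iff ha hb] at hns
  by_cases haX : a ∈ X
  · have hbX : b ∈ X := hX e he _ _ a b ha hb haX
    have hne2 : e ≠ e₂ := by
      rintro rfl
      exact hvX (hX e he _ _ a v ha h₂ haX)
    simp only [haX, hbX, if_true] at hns
    exact (not_satisfies_iff ha hb).2 hns (hs₁ e he hne2)
  · have hbX : b ∉ X := fun h => haX (hX e he _ _ b a hb ha h)
    have hne1 : e ≠ e₁ := by
      rintro rfl
      exact haX (hX e he _ _ u a h₁ ha huX)
    simp only [haX, hbX, if_false] at hns
    exact (not_satisfies_iff ha hb).2 hns (hs₂ e he hne1)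

/-- At a vertex of degree 1, flipping a function that fails only at the pendant edge repairs that
edge and disturbs no other. -/
theorem two_le_degreeIn (hC : G.IsMinimalUnbalanced C) {v : V} (hv : G.Touches C v) :
    2 ≤ G.degreeIn C v := by
  classical
  by_contra! hlt
  obtain ⟨e, he, i, hi⟩ := hv
  rw [degreeIn_eq_card] at hlt
  have huniq : ∀ e' ∈ C, ∀ j, G.ends e' j = some v → e' = e ∧ j = i := by
    intro e' he' j hj
    have := Finset.card_le_one.1 (Nat.le_of_lt_succ hlt) (e', j) (by simp [he', hj]) (e, i)
      (by simp [Finset.mem_coe.1 he, hi])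
    simpa using this
  obtain ⟨s, hs⟩ := hC.minimal e he
  obtain ⟨a, b, ha, hb⟩ := exists_ends_of_not_isOuterEdge (hC.not_outer e he)
  refine hC.not_satisfies (s := SignedGraph.flip {v} s) (e := e) ?_ ?_
  · intro e' he' hne
    refine (hs e' he' hne).flip fun x y hx hy => ?_
    simp only [Set.mem_singleton_iff]
    constructor
    · rintro rfl
      exact (hne (huniq e' he' 0 hx).1).elim
    · rintro rfl
      exact (hne (huniq e' he' 1 hy).1).elim
  · refine satisfies_flip_of_not_satisfies ha hb (hC.not_satisfies hs) ?_
    have h0 := fun h => (huniq e he 0 h).2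
    have h1 := fun h => (huniq e he 1 h).2
    simp only [Set.mem_singleton_iff]
    fin_cases i
    · have hav : a = v := by simpa [ha] using hi
      exact ⟨fun _ h => absurd (h1 (by rw [hb, h])) (by decide), fun _ => hav⟩
    · have hbv : b = v := by simpa [hb] using hi
      exact ⟨fun h => absurd (h0 (by rw [ha, h])) (by decide), fun h => (h hbv).elim⟩

-- The incidence vectors of C are independent over ℚ: pairing a linear relation with a function s
-- that fails only at e kills every other edge and gives ±2 at e.
open Classical in
theorem card_le_card_touches [Fintype V] (hC : G.IsMinimalUnbalanced C) :
    C.card ≤ (Finset.univ.filter fun v => G.Touches C v).card := by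
  let x : C → {v // G.Touches C v} → ℚ := fun e v => G.incidence v.1 (G.refArc e)
  have hx : LinearIndependent ℚ x := by
    rw [Fintype.linearIndependent_iff]
    intro c hc e
    obtain ⟨s, hs⟩ := hC.minimal e e.2
    have hpair : ∀ e' : C, ∑ v : {v // G.Touches C v}, ((s v.1 : ℤ) : ℚ) * x e' v =
        (((G.ends e' 0).elim 0 (fun v => (s v : ℤ)) -
          (G.sign e' : ℤ) * (G.ends e' 1).elim 0 (fun v => (s v : ℤ)) : ℤ) : ℚ) := by
      intro e'
      have h0 : ∀ v, ¬ G.Touches C v → G.incidence v (G.refArc e') = 0 := fun v hv =>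
        Finset.sum_eq_zero fun i _ => if_neg fun h => hv ⟨e', e'.2, i, h⟩
      rw [← smul_eq_mul, ← sum_incidence_smul, Int.cast_sum,
        ← Finset.sum_filter_of_ne (p := fun v => G.Touches C v), Finset.sum_subtype
          (p := fun v => G.Touches C v) _ (by simp)]
      · simp [x, mul_comm]
      · infer_instance
      · intro v _ h
        by_contra hv
        exact h (by simp [h0 v hv])
    have hz : ∑ v : {v // G.Touches C v}, ((s v.1 : ℤ) : ℚ) * (∑ e', c e' • x e') v = 0 :=
      Finset.sum_eq_zero fun v _ => by rw [hc]; simp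
    simp only [Finset.sum_apply, Pi.smul_apply, smul_eq_mul, Finset.mul_sum] at hz
    rw [Finset.sum_comm] at hz
    simp only [mul_left_comm _ (c _), ← Finset.mul_sum, hpair] at hz
    rw [Finset.sum_eq_single e] at hz
    · obtain ⟨a, b, ha, hb⟩ := exists_ends_of_not_isOuterEdge (hC.not_outer e e.2)
      have h2 := (not_satisfies_iff ha hb).1 (hC.not_satisfies hs)
      have h3 : ((G.sign e : ℤ) * (s b : ℤ)) = - (s a : ℤ) := by
        rw [h2]
        simp
      simp only [ha, hb, Option.elim_some, h3] at hz
      rcases Int.units_eq_one_or (s a) with h4 | h4 <;> rw [h4] at hz <;> norm_num at hz <;>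
        exact hz
    · intro e' _ hne
      obtain ⟨a, b, ha, hb, h⟩ := hs e' e'.2 fun h => hne (Subtype.ext h)
      simp [ha, hb, h]
    · simp
  have := hx.fintype_card_le_finrank
  simpa [Fintype.card_subtype] using this

/-- The degrees sum to 2|C|, at most twice the number of touched vertices, while each is at least 2;
so equality holds everywhere. -/
theorem degreeIn_eq_two [Fintype V] (hC : G.IsMinimalUnbalanced C) {v : V} (hv : G.Touches C v) :
    G.degreeIn C v = 2 := by
  classical
  have hsum : ∑ v ∈ Finset.univ.filter (fun v => G.Touches C v), G.degreeIn C v = 2 * C.card := by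
    rw [Finset.sum_filter_of_ne fun w _ h => not_imp_comm.1 degreeIn_eq_zero h]
    have h := G.prod_ends_eq C fun _ => Multiplicative.ofAdd (1 : ℕ)
    have h1 : ∀ e ∈ C, (G.ends e 0).elim 1 (fun _ => Multiplicative.ofAdd (1 : ℕ)) *
        (G.ends e 1).elim 1 (fun _ => Multiplicative.ofAdd (1 : ℕ)) =
          Multiplicative.ofAdd (2 : ℕ) := by
      intro e he
      obtain ⟨a, b, ha, hb⟩ := exists_ends_of_not_isOuterEdge (hC.not_outer e he)
      simp only [ha, hb, Option.elim_some]
      rfl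
    rw [Finset.prod_congr rfl h1, Finset.prod_const] at h
    simp only [← ofAdd_nsmul, ← ofAdd_sum] at h
    have := Multiplicative.ofAdd.injective h
    simpa [mul_comm] using this.symm
  have hle : ∑ v ∈ Finset.univ.filter (fun v => G.Touches C v), 2 ≤
      ∑ v ∈ Finset.univ.filter (fun v => G.Touches C v), G.degreeIn C v :=
    Finset.sum_le_sum fun w hw => hC.two_le_degreeIn (Finset.mem_filter.1 hw).2
  have heq : ∑ v ∈ Finset.univ.filter (fun v => G.Touches C v), 2 =
      ∑ v ∈ Finset.univ.filter (fun v => G.Touches C v), G.degreeIn C v := by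
    refine le_antisymm hle ?_
    rw [hsum, Finset.sum_const, smul_eq_mul, mul_comm]
    exact Nat.mul_le_mul_right 2 hC.card_le_card_touches
  exact ((Finset.sum_eq_sum_iff_of_le fun w hw =>
    hC.two_le_degreeIn (Finset.mem_filter.1 hw).2).1 heq v (by simpa using hv)).symm

theorem isNegativeCircle [Fintype V] (hC : G.IsMinimalUnbalanced C) : G.IsNegativeCircle C := by
  classical
  refine ⟨⟨hC.nonempty, hC.not_outer, fun v => hC.degreeIn_eq_two, fun u v => hC.connected⟩, ?_⟩
  obtain ⟨e, he⟩ := hC.nonempty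
  obtain ⟨s, hs⟩ := hC.minimal e he
  have h1 := prod_ends_eq_one (fun v => hC.degreeIn_eq_two) s
  have h2 := hC.not_satisfies hs
  obtain ⟨a, b, ha, hb⟩ := exists_ends_of_not_isOuterEdge (hC.not_outer e he)
  rw [not_satisfies_iff ha hb] at h2
  rw [← Finset.mul_prod_erase _ _ he] at h1 ⊢
  rw [Finset.prod_congr rfl fun e' he' =>
    (hs e' (Finset.mem_of_mem_erase he') (Finset.ne_of_mem_erase he')).sign_eq]
  simp only [ha, hb, Option.elim_some] at h1
  rw [h2, neg_mul, mul_assoc, Int.units_mul_self, mul_one, neg_mul] at h1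
  exact neg_eq_iff_eq_neg.1 h1

end IsMinimalUnbalanced

/-- Edges are discarded while the set stays unbalanced; what remains is minimal. -/
theorem exists_isNegativeCircle_subset [Fintype V] {G : SignedGraph V E} (S : Finset E)
    (ho : ∀ e ∈ S, ¬ G.IsOuterEdge e) (hS : ∀ s, ∃ e ∈ S, ¬ G.Satisfies s e) :
    ∃ C ⊆ S, G.IsNegativeCircle C := by
  classical
  induction S using Finset.strongInduction with
  | H S ih =>
    by_cases h : ∀ e ∈ S, ∃ s, ∀ e' ∈ S, e' ≠ e → G.Satisfies s e'
    · exact ⟨S, subset_rfl, IsMinimalUnbalanced.isNegativeCircle ⟨ho, hS, h⟩⟩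
    · push Not at h
      obtain ⟨e, he, h⟩ := h
      obtain ⟨C, hC, hC'⟩ := ih (S.erase e) (Finset.erase_ssubset he)
        (fun e' he' => ho e' (Finset.mem_of_mem_erase he')) fun s => by
          obtain ⟨e', he', hne, h'⟩ := h s
          exact ⟨e', Finset.mem_erase.2 ⟨hne, he'⟩, h'⟩
      exact ⟨C, hC.trans (Finset.erase_subset e S), hC'⟩

/-! ### Connected signed graphs -/

theorem ncard_connectedComponent {G : SimpleGraph V} (hG : G.Connected)
    {p : G.ConnectedComponent → Prop} {P : Prop} [Decidable P] (hp : ∀ K, p K ↔ P) :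
    {K | p K}.ncard = if P then 1 else 0 := by
  obtain ⟨r⟩ := hG.nonempty
  have hK : ∀ K, K = G.connectedComponentMk r := fun K => by
    induction K using SimpleGraph.ConnectedComponent.ind with
    | h v => exact SimpleGraph.ConnectedComponent.sound (hG.preconnected v r)
  by_cases h : P
  · rw [if_pos h, Set.ncard_eq_one]
    exact ⟨G.connectedComponentMk r, Set.ext fun K => by simp [hp, h, ← hK K]⟩
  · simp [hp, h]

theorem mem_supp_of_connected {G : SimpleGraph V} (hG : G.Connected) (K : G.ConnectedComponent)
    (v : V) : v ∈ K.supp := by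
  induction K using SimpleGraph.ConnectedComponent.ind with
  | h w => exact SimpleGraph.ConnectedComponent.sound (hG.preconnected v w)

theorem meets_supp_of_connected {G : SignedGraph V E} {S : Set E} (hS : (G.adjGraph S).Connected)
    (K : (G.adjGraph S).ConnectedComponent) (e : E) : G.Meets e K.supp := by
  obtain ⟨i, v, hv⟩ := G.exists_end e
  exact ⟨i, v, mem_supp_of_connected hS K v, hv⟩

open Classical in
theorem numSwitchable_of_connected {G : SignedGraph V E} {S : Set E}
    (hS : (G.adjGraph S).Connected) :
    G.numSwitchable S = if ∃ s, ∀ e ∈ S, G.Satisfies s e then 1 else 0 :=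
  ncard_connectedComponent hS fun K => by simp [IsSwitchable, meets_supp_of_connected hS]

open Classical in
theorem numUnswitchable_of_connected {G : SignedGraph V E} {S : Set E}
    (hS : (G.adjGraph S).Connected) : G.numUnswitchable S =
      if ¬ (∃ s, ∀ e ∈ S, G.Satisfies s e) ∧ ¬ (∃ e ∈ S, G.IsOuterEdge e) then 1 else 0 :=
  ncard_connectedComponent hS fun K => by
    simp [IsSwitchable, HasOuterAt, meets_supp_of_connected hS]

open Classical in
theorem numBalanced_of_connected {G : SignedGraph V E} (hG : G.IsConnected) :
    G.numBalanced = if ¬ G.HasOuterEdge ∧ ¬ G.HasNegativeCircle then 1 else 0 := by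
  refine ncard_connectedComponent hG fun K => ?_
  have hK : ∀ v, v ∈ K.supp := mem_supp_of_connected hG K
  simp only [IsBalancedComponent, hK, not_true_eq_false, HasOuterEdge, HasNegativeCircle]
  refine and_congr ?_ ?_
  · refine ⟨fun h ⟨e, he⟩ => ?_, fun h e he => (h ⟨e, he⟩).elim⟩
    obtain ⟨i, v, hv⟩ := G.exists_end e
    exact h e he i v hv
  · refine ⟨fun h ⟨C, hC⟩ => ?_, fun h C hC => (h ⟨C, hC⟩).elim⟩
    obtain ⟨e, he⟩ := hC.1.nonempty
    obtain ⟨i, v, hv⟩ := G.exists_end e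
    exact h C hC v ⟨e, he, i, hv⟩

theorem exists_satisfies_iff [Fintype V] [Fintype E] (G : SignedGraph V E) :
    (∃ s, ∀ e, G.Satisfies s e) ↔ ¬ G.HasOuterEdge ∧ ¬ G.HasNegativeCircle := by
  constructor
  · rintro ⟨s, hs⟩
    refine ⟨fun ⟨e, he⟩ => (hs e).not_isOuterEdge he, fun ⟨C, hC⟩ => ?_⟩
    obtain ⟨e, -, he⟩ := hC.exists_not_satisfies s
    exact he (hs e)
  · rintro ⟨ho, hn⟩
    by_contra! h
    obtain ⟨C, -, hC⟩ := G.exists_isNegativeCircle_subset Finset.univ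
      (fun e _ he => ho ⟨e, he⟩) fun s => by simpa using h s
    exact hn ⟨C, hC⟩

theorem coe_cycleRankOn_univ [Fintype V] [Fintype E] {G : SignedGraph V E} (hG : G.IsConnected) :
    (G.cycleRankOn Finset.univ : ℤ) = G.cycleRank := by
  classical
  have h := G.cycleRankOn_add_card Finset.univ
  have h2 : G.numSwitchable (Finset.univ : Finset E) = G.numBalanced := by
    rw [Finset.coe_univ, numSwitchable_of_connected hG, numBalanced_of_connected hG]
    simp [exists_satisfies_iff]
  rw [h2, Finset.card_univ] at h
  rw [cycleRank, rank]
  omega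

-- This is the exponent of t in the term S = E, which decides whether φ₀ or φ₁ is the monic
-- coefficient.
open Classical in
theorem numUnswitchable_univ [Fintype V] [Fintype E] {G : SignedGraph V E} (hG : G.IsConnected) :
    G.numUnswitchable (Finset.univ : Finset E) =
      if G.HasNegativeCircle ∧ ¬ G.HasOuterEdge then 1 else 0 := by
  rw [Finset.coe_univ, numUnswitchable_of_connected hG]
  simp only [Set.mem_univ, true_implies, exists_satisfies_iff, true_and]
  congr 1
  simp only [HasOuterEdge, eq_iff_iff]
  tauto

/-! ### Frustration -/

theorem negCycleRank_le {G : SignedGraph V E} {T : Finset E}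
    (hT : ∀ C, G.IsNegativeCircle C → ¬ Disjoint C T) : G.negCycleRank ≤ T.card :=
  Nat.sInf_le ⟨T, rfl, hT⟩

theorem exists_card_eq_negCycleRank [Fintype E] (G : SignedGraph V E) :
    ∃ T : Finset E, T.card = G.negCycleRank ∧ ∀ C, G.IsNegativeCircle C → ¬ Disjoint C T := by
  refine Nat.sInf_mem (s := {k | ∃ S : Finset E, S.card = k ∧
    ∀ C, G.IsNegativeCircle C → ¬ Disjoint C S}) ⟨_, Finset.univ, rfl, fun C hC h => ?_⟩
  obtain ⟨e, he⟩ := hC.1.nonempty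
  exact Finset.disjoint_left.1 h he (Finset.mem_univ e)

/-- Each counted component contains a negative circle, hence an edge of an optimal deletion set T;
distinct components yield distinct edges. -/
theorem numUnswitchable_le_negCycleRank [Fintype V] [Fintype E] (G : SignedGraph V E)
    (S : Finset E) : G.numUnswitchable S ≤ G.negCycleRank := by
  classical
  obtain ⟨T, hT, hTC⟩ := G.exists_card_eq_negCycleRank
  have hex : ∀ K : {K | ¬ G.IsSwitchable (S : Set E) K ∧ ¬ G.HasOuterAt S K},
      ∃ e : T, e.1 ∈ S ∧ G.Meets e.1 K.1.supp ∧ ¬ G.IsOuterEdge e.1 := by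
    rintro ⟨K, hK, ho⟩
    obtain ⟨C, hCS, hC⟩ := G.exists_isNegativeCircle_subset
      (S.filter fun e => G.Meets e K.supp)
      (fun e he heo => ho ⟨e, (Finset.mem_filter.1 he).1, (Finset.mem_filter.1 he).2, heo⟩)
      fun s => by
        by_contra! h
        exact hK ⟨s, fun e he hm => h e (Finset.mem_filter.2 ⟨he, hm⟩)⟩
    obtain ⟨e, heC, heT⟩ := Finset.not_disjoint_iff.1 (hTC C hC)
    have he := Finset.mem_filter.1 (hCS heC)
    exact ⟨⟨e, heT⟩, he.1, he.2, hC.1.not_outer e heC⟩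
  choose F hF using hex
  have hinj : Function.Injective F := by
    intro K K' h
    obtain ⟨u, v, hu, hv⟩ := exists_ends_of_not_isOuterEdge (hF K).2.2
    have hS : (F K).1 ∈ (S : Set E) := (hF K).1
    have h1 := (mem_supp_of_meets hS hu hv (hF K).2.1).1
    have h2 := (mem_supp_of_meets hS hu hv (h ▸ (hF K').2.1)).1
    exact Subtype.ext (h1.symm.trans h2)
  have hle := Nat.card_le_card_of_injective F hinj
  rwa [Nat.card_eq_fintype_card (α := T), Fintype.card_coe, hT] at hle

/-- Without outer-edges every component is switchable, and the switching functions glue along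
components. -/
theorem exists_satisfies_of_numUnswitchable_eq_zero [Fintype V] {G : SignedGraph V E}
    (ho : ¬ G.HasOuterEdge) {S : Set E} (hS : G.numUnswitchable S = 0) :
    ∃ s, ∀ e ∈ S, G.Satisfies s e := by
  have hsw : ∀ K, G.IsSwitchable S K := by
    intro K
    by_contra h
    have := (Set.ncard_eq_zero).1 hS
    exact (Set.eq_empty_iff_forall_notMem.1 this K) ⟨h, fun ⟨e, _, _, he⟩ => ho ⟨e, he⟩⟩
  choose s hs using hsw
  refine ⟨fun v => s ((G.adjGraph S).connectedComponentMk v) v, fun e he => ?_⟩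
  obtain ⟨u, v, hu, hv⟩ := exists_ends_of_not_isOuterEdge fun h => ho ⟨e, h⟩
  have huv := SimpleGraph.ConnectedComponent.sound (reachable_of_ends he hu hv)
  by_contra h
  rw [not_satisfies_iff hu hv, huv, ← not_satisfies_iff hu hv] at h
  exact h (hs _ e he ⟨1, v, rfl, hv⟩)

/-- In a connected signed graph without outer-edges, a switching function satisfying the edges of
`S` can be chosen so that the satisfied edges form a connected spanning subgraph. -/
theorem exists_satisfies_connected [Fintype V] [Fintype E] {G : SignedGraph V E}
    (hG : G.IsConnected) (ho : ¬ G.HasOuterEdge) {S : Set E} {s₀ : V → ℤˣ}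
    (hs₀ : ∀ e ∈ S, G.Satisfies s₀ e) :
    ∃ s, (∀ e ∈ S, G.Satisfies s e) ∧ (G.adjGraph {e | G.Satisfies s e}).Connected := by
  classical
  -- Take s with the most satisfied edges. If these did not connect V, flipping s on one of their
  -- components would keep them all and gain an edge leaving it.
  obtain ⟨s, hs, hmax⟩ := Finset.exists_max_image
    (Finset.univ.filter fun s : V → ℤˣ => ∀ e ∈ S, G.Satisfies s e)
    (fun s => (Finset.univ.filter fun e => G.Satisfies s e).card)
    ⟨s₀, Finset.mem_filter.2 ⟨Finset.mem_univ _, hs₀⟩⟩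
  simp only [Finset.mem_filter, Finset.mem_univ, true_and] at hs hmax
  have := hG.nonempty
  refine ⟨s, hs, ⟨fun a b => ?_⟩⟩
  by_contra hab
  let X : Set V := {w | (G.adjGraph {e | G.Satisfies s e}).Reachable a w}
  have hX : ∀ e, G.Satisfies s e → ∀ u v, G.ends e 0 = some u → G.ends e 1 = some v →
      (u ∈ X ↔ v ∈ X) := fun e he u v hu hv =>
    have h := reachable_of_ends (S := {e | G.Satisfies s e}) he hu hv
    ⟨fun hu => SimpleGraph.Reachable.trans hu h, fun hv => SimpleGraph.Reachable.trans hv h.symm⟩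
  obtain ⟨p⟩ := hG.preconnected a b
  obtain ⟨⟨⟨x, y⟩, _, e, _, hxy⟩, _, hx, hy⟩ :=
    p.exists_boundary_dart X (SimpleGraph.Reachable.refl a) hab
  obtain ⟨u, v, hu, hv⟩ := exists_ends_of_not_isOuterEdge fun h => ho ⟨e, h⟩
  have huv : u ∈ X ↔ v ∉ X := by
    simp only [hu, hv, Option.some.injEq] at hxy
    rcases hxy with ⟨rfl, rfl⟩ | ⟨rfl, rfl⟩
    · exact iff_of_true hx hy
    · exact iff_of_false hy (not_not.2 hx)
  have he : ¬ G.Satisfies s e := fun h => by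
    have := hX e h u v hu hv
    tauto
  have hle := hmax (flip X s) fun e he => (hs e he).flip (hX e (hs e he))
  refine absurd hle (not_le.2 (Finset.card_lt_card ?_))
  refine Finset.ssubset_iff_subset_ne.2 ⟨fun e' he' => ?_, fun heq => ?_⟩
  · simp only [Finset.mem_filter, Finset.mem_univ, true_and] at he' ⊢
    exact he'.flip (hX e' he')
  · have : e ∈ Finset.univ.filter fun e => G.Satisfies s e := by
      rw [heq]
      simpa using satisfies_flip_of_not_satisfies hu hv he huv
    exact he (by simpa using this)

/-- Enlarge S to the connected spanning set T of all edges satisfied by some s. Its cycle-rank is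
|T| - |V| + 1, and deleting the complement of T destroys all negative circles. -/
theorem cycleRankOn_le_posCycleRank [Fintype V] [Fintype E] {G : SignedGraph V E}
    (hG : G.IsConnected) (ho : ¬ G.HasOuterEdge) {S : Finset E}
    (hS : G.numUnswitchable (S : Set E) = 0) : (G.cycleRankOn S : ℤ) ≤ G.posCycleRank := by
  classical
  obtain ⟨s₀, hs₀⟩ := exists_satisfies_of_numUnswitchable_eq_zero ho hS
  obtain ⟨s, hs, hconn⟩ := exists_satisfies_connected hG ho hs₀
  let T : Finset E := Finset.univ.filter fun e => G.Satisfies s e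
  have hT : (T : Set E) = {e | G.Satisfies s e} := by simp [T]
  have h1 : G.cycleRankOn S ≤ G.cycleRankOn T :=
    G.cycleRankOn_mono fun e he => by simpa [T] using hs e he
  have h2 := G.cycleRankOn_add_card T
  have h3 : G.numSwitchable T = 1 := by
    rw [hT, numSwitchable_of_connected hconn, if_pos ⟨s, fun e he => he⟩]
  have h4 : G.negCycleRank ≤ Tᶜ.card := by
    refine negCycleRank_le fun C hC hdis => ?_
    obtain ⟨e, he, hns⟩ := hC.exists_not_satisfies s
    exact Finset.disjoint_left.1 hdis he (by simpa [T] using hns)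
  have h5 : G.unsigned.numBalanced = 1 := by
    have hc : G.unsigned.IsConnected := hG
    rw [numBalanced_of_connected hc, if_pos]
    refine ⟨ho, fun ⟨C, hC⟩ => ?_⟩
    have := hC.2
    simp [unsigned] at this
  have h6 := Finset.card_add_card_compl T
  rw [posCycleRank, cycleRank, rank, h5]
  omega

/-! ### The degree property -/

theorem natDegree_flowPolynomial_le [Fintype V] [Fintype E] (G : SignedGraph V E) :
    G.flowPolynomial.natDegree ≤ G.negCycleRank :=
  Polynomial.natDegree_sum_le_of_forall_le _ _ fun S _ =>
    (Polynomial.natDegree_monomial_le _).trans (G.numUnswitchable_le_negCycleRank S)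

theorem natDegree_coeff_zero_le_posCycleRank [Fintype V] [Fintype E] {G : SignedGraph V E}
    (hG : G.IsConnected) (ho : ¬ G.HasOuterEdge) :
    ((G.flowPolynomial.coeff 0).natDegree : ℤ) ≤ G.posCycleRank := by
  -- The empty set shows that cr⁺ is nonnegative, which covers φ₀ = 0, whose `natDegree` is 0.
  have h0 : G.numUnswitchable ((∅ : Finset E) : Set E) = 0 := by
    have h : ∀ K, G.IsSwitchable ((∅ : Finset E) : Set E) K := fun K => ⟨1, by simp⟩
    simp [numUnswitchable, h]
  have hpos : 0 ≤ G.posCycleRank :=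
    (Int.natCast_nonneg _).trans (cycleRankOn_le_posCycleRank hG ho h0)
  obtain ⟨n, hn⟩ := Int.eq_ofNat_of_zero_le hpos
  rw [hn, coeff_flowPolynomial]
  refine Nat.cast_le.2 (Polynomial.natDegree_sum_le_of_forall_le _ _ fun S hS => ?_)
  refine (natDegree_neg_one_pow_mul_X_pow_le _ _).trans ?_
  have := cycleRankOn_le_posCycleRank hG ho (Finset.mem_filter.1 hS).2
  rw [hn] at this
  exact_mod_cast this

/-- Two vertices, each with a negative loop, joined by a positive edge. -/
def twoNegativeLoops : SignedGraph (Fin 2) (Fin 3) where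
  ends := ![![some 0, some 0], ![some 1, some 1], ![some 0, some 1]]
  exists_end e := by fin_cases e <;> exact ⟨0, _, rfl⟩
  sign := ![-1, -1, 1]

theorem twoNegativeLoops_not_hasOuterEdge : ¬ twoNegativeLoops.HasOuterEdge := by
  rintro ⟨e, i, h⟩
  fin_cases e <;> fin_cases i <;> simp [twoNegativeLoops] at h

theorem twoNegativeLoops_isConnected : twoNegativeLoops.IsConnected := by
  have h : (twoNegativeLoops.adjGraph Set.univ).Reachable 0 1 :=
    reachable_of_ends (e := 2) (Set.mem_univ _) rfl rfl
  refine ⟨fun u v => ?_⟩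
  fin_cases u <;> fin_cases v
  · exact SimpleGraph.Reachable.refl _
  · exact h
  · exact h.symm
  · exact SimpleGraph.Reachable.refl _

theorem twoNegativeLoops_hasNegativeCircle : twoNegativeLoops.HasNegativeCircle := by
  refine ⟨{0}, IsMinimalUnbalanced.isNegativeCircle
    ⟨fun e _ he => twoNegativeLoops_not_hasOuterEdge ⟨e, he⟩, fun s => ?_, fun e he => ?_⟩⟩
  · refine ⟨0, by simp, ?_⟩
    rw [not_satisfies_iff (u := 0) (v := 0) rfl rfl]
    simp [twoNegativeLoops]
  · exact ⟨1, fun e' he' hne => (hne (by simp_all)).elim⟩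

theorem twoNegativeLoops_isFlow_iff {A : Type*} [AddCommGroup A] (f : Fin 3 → A) :
    twoNegativeLoops.IsFlow f ↔ 2 • f 0 + f 2 = 0 ∧ 2 • f 1 - f 2 = 0 := by
  simp [IsFlow, Fin.forall_fin_two, Fin.sum_univ_three, incidence, refArc, twoNegativeLoops,
    Fin.sum_univ_two, two_nsmul, add_smul, sub_eq_add_neg]

-- A flow is determined by a = f 0 and the 2-torsion element b = f 0 + f 1, with f 2 = -2a. It is
-- nowhere zero exactly when 2a ≠ 0, since a = 0 or a = b would give 2a = 0. The count is (x - t)t,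
-- divisible by t.
open Polynomial in
theorem twoNegativeLoops_isFlowPolynomial :
    twoNegativeLoops.IsFlowPolynomial (C X * X - X ^ 2) := by
  classical
  intro A _ _
  have := Fintype.ofFinite A
  have hcard : Nat.card {f : Fin 3 → A // twoNegativeLoops.IsFlow f ∧ ∀ e, f e ≠ 0} =
      Nat.card ({a : A // ¬ 2 • a = 0} × {a : A // 2 • a = 0}) := by
    refine Nat.card_congr
      { toFun := fun f => (⟨f.1 0, ?_⟩, ⟨f.1 0 + f.1 1, ?_⟩)
        invFun := fun p => ⟨![p.1.1, p.2.1 - p.1.1, - (2 • p.1.1)], ?_, ?_⟩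
        left_inv := ?_
        right_inv := ?_ }
    · have h := ((twoNegativeLoops_isFlow_iff f.1).1 f.2.1).1
      intro h0
      rw [h0, zero_add] at h
      exact f.2.2 2 h
    · have h := (twoNegativeLoops_isFlow_iff f.1).1 f.2.1
      have hadd : 2 • (f.1 0 + f.1 1) = (2 • f.1 0 + f.1 2) + (2 • f.1 1 - f.1 2) := by abel
      rw [hadd, h.1, h.2, add_zero]
    · rw [twoNegativeLoops_isFlow_iff]
      have h := p.2.2
      simp [smul_sub, h]
    · have h := p.2.2
      have h' := p.1.2
      have h1 : p.1.1 ≠ 0 := fun h0 => h' (by simp [h0])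
      have h2 : p.2.1 - p.1.1 ≠ 0 := fun h0 => h' (by rw [← sub_eq_zero.1 h0, h])
      intro e
      fin_cases e
      · exact h1
      · exact h2
      · exact neg_ne_zero.2 h'
    · intro f
      have h := ((twoNegativeLoops_isFlow_iff f.1).1 f.2.1).1
      refine Subtype.ext (funext fun e => ?_)
      fin_cases e
      · rfl
      · simp
      · exact neg_eq_of_add_eq_zero_right h
    · intro p
      refine Prod.ext (Subtype.ext rfl) (Subtype.ext ?_)
      simp
  have hsum : Nat.card {a : A // 2 • a = 0} + Nat.card {a : A // ¬ 2 • a = 0} = Nat.card A := by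
    rw [← Nat.card_sum]
    exact Nat.card_congr (Equiv.sumCompl _)
  have h2 : {a : A | 2 • a = 0}.ncard = Nat.card {a : A // 2 • a = 0} := rfl
  rw [ncard_nowhereZeroFlows, hcard, Nat.card_prod, h2, ← hsum]
  simp [Polynomial.evalEval]
  ring

end SignedGraph

open SignedGraph

theorem mainTheorem9 :
    (∀ (V E : Type*) [Fintype V] [Fintype E] (G : SignedGraph V E), G.IsConnected →
      ∃ φ : Polynomial (Polynomial ℤ), G.IsFlowPolynomial φ ∧
        (∀ ψ, G.IsFlowPolynomial ψ → ψ = φ) ∧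
        (φ ≠ 0 →
          (∃ d : ℕ, d ≤ G.negCycleRank ∧ φ.coeff d ≠ 0 ∧
            φ = ∑ i ∈ Finset.range (d + 1), Polynomial.X ^ i * Polynomial.C (φ.coeff i)) ∧
          (¬ G.HasNegativeCircle →
            φ = Polynomial.C (φ.coeff 0) ∧ (φ.coeff 0).Monic ∧
              ((φ.coeff 0).natDegree : ℤ) = G.cycleRank) ∧
          (G.HasOuterEdge →
            (φ.coeff 0).Monic ∧ ((φ.coeff 0).natDegree : ℤ) = G.cycleRank) ∧
          (G.HasNegativeCircle → ¬ G.HasOuterEdge →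
            ((φ.coeff 0).natDegree : ℤ) ≤ G.posCycleRank ∧
            (φ.coeff 1).Monic ∧ ((φ.coeff 1).natDegree : ℤ) = G.cycleRank))) ∧
    (∃ (V E : Type) (_ : Fintype V) (_ : Fintype E) (G : SignedGraph V E)
      (φ : Polynomial (Polynomial ℤ)), G.IsConnected ∧ G.IsFlowPolynomial φ ∧ φ ≠ 0 ∧
        G.HasNegativeCircle ∧ ¬ G.HasOuterEdge ∧ φ.coeff 0 = 0) := by
  classical
  refine ⟨fun V E _ _ G hG => ⟨G.flowPolynomial, G.isFlowPolynomial_flowPolynomial,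
    fun ψ hψ => G.isFlowPolynomial_flowPolynomial.unique hψ, fun h0 => ?_⟩, ?_⟩
  · have hmonic := G.monic_coeff_flowPolynomial h0
    rw [numUnswitchable_univ hG] at hmonic
    have hrank := coe_cycleRankOn_univ hG
    refine ⟨⟨G.flowPolynomial.natDegree, G.natDegree_flowPolynomial_le, ?_, ?_⟩,
      fun hn => ?_, fun ho => ?_, fun hn ho => ⟨natDegree_coeff_zero_le_posCycleRank hG ho, ?_⟩⟩
    · exact Polynomial.leadingCoeff_ne_zero.2 h0
    · simp_rw [mul_comm (Polynomial.X ^ _)]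
      exact G.flowPolynomial.as_sum_range_C_mul_X_pow
    · rw [if_neg fun h => hn h.1] at hmonic
      -- With no negative circles the empty deletion set suffices, so φ has degree 0 in t.
      have hneg : G.negCycleRank ≤ 0 := negCycleRank_le (T := ∅) fun C hC => (hn ⟨C, hC⟩).elim
      refine ⟨Polynomial.eq_C_of_natDegree_eq_zero ?_, hmonic.1, by rw [hmonic.2, hrank]⟩
      exact Nat.le_zero.1 (G.natDegree_flowPolynomial_le.trans hneg)
    · rw [if_neg fun h => h.2 ho] at hmonic
      exact ⟨hmonic.1, by rw [hmonic.2, hrank]⟩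
    · rw [if_pos ⟨hn, ho⟩] at hmonic
      exact ⟨hmonic.1, by rw [hmonic.2, hrank]⟩
  · refine ⟨Fin 2, Fin 3, inferInstance, inferInstance, twoNegativeLoops, _,
      twoNegativeLoops_isConnected, twoNegativeLoops_isFlowPolynomial, fun h => ?_,
      twoNegativeLoops_hasNegativeCircle, twoNegativeLoops_not_hasOuterEdge, by simp⟩
    -- The coefficient of t² in xt - t² is -1.
    have := congrArg (fun p => Polynomial.coeff p 2) h
    simp at this
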